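/- **Setting.** Let $n\ge 2$, let $v_1,\dots,v_p\in\mathbb Z^n$ and $\lambda_1,\dots,\lambda_p\in\mathbb R$ (for instance the primitive ray generators of the fan of a toric Fano $n$-fold and the coefficients of an ample toric divisor). For small $t>0$ put $$W_\Sigma(z)=1+\sum_{k=1}^p t^{\lambda_k}z^{v_k},\qquad Y^t=\{(z,u,v)\in(\mathbb C^*)^n\times\mathbb C^2: uv=W_\Sigma(z)\},$$ $\mathrm{Log}_t(z)=(\log|z_i|/\log t)_i$, $\chi_k(x)=\lambda_k+\langle v_k,x\rangle$, $G_{\rm trop}=\{\chi_k\ge 0\ \forall k\}$, $F_{j,\rm trop}=G_{\rm trop}\cap\{\chi_j=0\}$, and let $s_{>0}(x)=(t^{x_i})_i$. For $\sigma\subset\mathbb R^n$ and $s\in(\mathbb C^*)^n$ write $\sigma(s)=\{e^{2\pi\sqrt{-1}m}\cdot s: m\in\sigma\}$. *Neighbourhoods.* Fix $j$, and open sets $U_j''\subset\subset U_j'\subset\subset U_j$ with $U_j$ convex and $U_j''\cap F_{j,\rm trop}\neq\emptyset$, constants $0<c_j<c_k$ $(k\ne j)$ with $\chi_j<c_j$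 and $\chi_k>c_k$ on $U_j$, and a smooth $\rho:\mathbb R^n\to[0,1]$ equal to $1$ on $U_j''$ and $0$ off $U_j'$, such that for some $\varepsilon>0$, $\rho(x+sv_j)=\rho(x)$ for all $x\in U_j\cap F_{j,\rm trop}$, $|s|<\varepsilon$. Put $W_{\Sigma,j}(z)=W_\Sigma(z)-\rho(\mathrm{Log}_tz)\sum_{k\ne j}t^{\lambda_k}z^{v_k}$. *Deformation.* Let $R>R'>R''>1$ with $R''>\tfrac12(1+\sum_k|t^{\lambda_k}z^{v_k}|)$ whenever $\mathrm{Log}_t z\in U_j$, let $\tau:\mathbb C^2\to[0,1]$ be smooth, $\tau=1$ where $\frac12|u|^2,\frac12|v|^2\le R''$ and $\tau=0$ unless $\frac12|u|^2,\frac12|v|^2\le R'$. Let $Y^t_j$ be the part of $Y^t$ with $\frac12|u|^2,\frac12|v|^2\le R$, $\mathrm{Log}_tz\in U_j$, and $Y^t_{j,\rm simple}$ the set given in the same region by $uv=W_\Sigma(z)-\tau(u,v)\rho(\mathrm{Log}_tz)\sum_{k\neq j}t^{\lambda_k}z^{v_k}$. Let $\Phi_j:Y_j^t\to Y^t_{j,\rm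 simple}$ be a symplectomorphism for the restrictions of $\omega_0=\sum_i dz_i\wedge d\bar z_i/|z_i|^2+du\wedge d\bar u+dv\wedge d\bar v$ which is the identity at all points that do not satisfy both $\frac12|u|^2,\frac12|v|^2\le R'$ and $\mathrm{Log}_tz\in U'_j$. *The end.* Let $\beta_{\rm trop}$ be the intersection with $G_{\rm trop}$ of $n-1$ tropical hypersurfaces $V(f_1),\dots,V(f_{n-1})$, and $e$ an edge of it, dual to the $(n-1)$-dimensional cell $\sigma_e=\sum_k[q_k,q_k']$, where $[q_k,q'_k]$ (with integral endpoints) is a 1-cell of the subdivision of the Newton polytope of $f_k$; put $\xi_k=q_k'-q_k$. Let $e$ have an end $a\in U_j\cap F_{j,\rm trop}$ and direction $v_j$, and let $\ell>0$ be such that the segment $r_a(\tau)=a+(1-\tau)\ell v_j$, $0\le\tau\le1$, lies on $e$ and in $U_j$, and $r_a(0)\notin U_j'$. Let $s(\tau)\in\mathrm{Log}_t^{-1}(r_a(\tau))$ be a continuous path with $s(0)=s_{>0}(r_a(0))$, $1+t^{\lambda_j}s(1)^{v_j}=0$, along which the phase of $s(\tau)^{v_j}$ runs counterclockwise (weakly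 monotonically) from $1$ to $-1$ through the upper half circle. Put $$\Gamma_a=\Phi_j^{-1}\{(z,u,v)\in Y^t_{j,\rm simple}: |u|=|v|,\ z\in\sigma_e(s(\tau)),\ \tau\in[0,1]\}.$$ *The added chain.* Let $\gamma\in\mathbb Z^n$ with $\langle\gamma,v_j\rangle=1$, $\tilde\sigma=\sigma_e+[0,\gamma]$, $r=r_{\rm add}:[0,1]\to U_j\setminus U_j'$ a continuous path with $r(\frac12)=r_a(0)$, such that for all $k\neq j$, $t^{\chi_j(r(0))}+(p-1)t^{c_k}<1$ and $t^{\chi_j(r(1))}>1+(p-1)t^{c_k}$. Let $r_0^\pm:[0,1]\to(0,\infty)$ be continuous with $2\sqrt{r_0^+r_0^-}=|W_\Sigma(s_{>0}(r))|$ at $\tau=0$ and $\tau=1$. With $\tilde\sigma(\tau)=\tilde\sigma(s_{>0}(r(\tau)))$, let $\Gamma_{\rm add}$ be the union of the following seven subsets of $Y^t$, where $\mu,\kappa\in[0,1]$ and $\theta\in[0,2\pi]$: * $\Gamma^{+,1}$: $z\in\tilde\sigma(\tau)$, $u=\sqrt{2r_0^+(\tau)}$, $\tau\in[0,\frac12]$;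 * $\Gamma_{av}$: $z\in\tilde\sigma(\frac12)$, $u=e^{\sqrt{-1}\kappa\arg(z^{v_j})}\sqrt{2r_0^+(\frac12)}$, where $\arg(z^{v_j})=2\pi\eta$ at the point of $\tilde\sigma(\frac12)$ given by $m+\eta\gamma$, $m\in\sigma_e$, $\eta\in[0,1]$; * $\Gamma^{+,2}$: $z\in\tilde\sigma(\tau)$, $u=e^{\sqrt{-1}\arg(z^{v_j})}\sqrt{2r_0^+(\tau)}$, $\tau\in[\frac12,1]$; * $\Gamma^-$: $z\in\tilde\sigma(\tau)$, $v=\sqrt{2r_0^-(\tau)}$, $\tau\in[0,1]$; * $\Gamma_{\rm in}$: $z\in\tilde\sigma(0)$, $u=e^{\sqrt{-1}\arg(\mu W_\Sigma(z)+1-\mu)}\left|\frac{W_\Sigma(z)}{W_\Sigma(s_{>0}(r(0)))}\right|^{\mu}\sqrt{2r_0^+(0)}$; * $\Gamma_{\rm out}$: $z\in\tilde\sigma(1)$, $v=e^{\sqrt{-1}\arg((\mu W_\Sigma(z)+(1-\mu)t^{\lambda_j}z^{v_j})/z^{v_j})}\left|\frac{W_\Sigma(z)}{W_\Sigma(s_{>0}(r(1)))}\right|^{\mu}\sqrt{2r_0^-(1)}$;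 * $\Gamma_{\rm co}$: $z\in\sigma_e(s_{>0}(r(\frac12)))$, $u=\big(\mu|W_\Sigma(z)|^{1/2}+(1-\mu)\sqrt{2r_0^+(\frac12)}\big)e^{\sqrt{-1}\theta}$. Put $\Gamma_{a,\rm total}=\Gamma_a\cup\Gamma_{\rm add}$; the choices are made so that $\Gamma_{\rm add}\subset Y_j^t$. *Singular fibers.* For $x\in U_j\cap F_{j,\rm trop}$ write $z_x(\tau,\alpha,\eta)=\exp\big(\log t\,(x+\tau v_j)+\sqrt{-1}(\alpha\gamma+\sum_k\eta_k\xi_k)\big)$. If for every $\eta\in[0,2\pi]^{n-1}$ there are unique $\tau=\tau_x(\eta)\in\mathbb R$, $\alpha=\alpha_x(\eta)\in\mathbb R/2\pi\mathbb Z$ with $x+\tau v_j\in U_j$ and $W_{\Sigma,j}(z_x(\tau,\alpha,\eta))=0$, the singular fiber $SF_{x,e}$ is the set of all $(z,u,v)$ with $z=z_x(\tau_x(\eta),\alpha_x(\eta)+\eta_a,\eta)$, $u=|W_{\Sigma,j}(z)|^{1/2}e^{\sqrt{-1}\theta_0}$, $v=W_{\Sigma,j}(z)|W_{\Sigma,j}(z)|^{-1/2}e^{-\sqrt{-1}\theta_0}$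 (read as $0$ where $W_{\Sigma,j}(z)=0$), $\eta\in[0,2\pi]^{n-1}$, $\eta_a,\theta_0\in[0,2\pi]$. **Proposition.** Given $v,\lambda,j$, the neighbourhoods with $\rho$, the $f_k$, the end $a$ of $e$ with $\ell$, the vector $\gamma$ and the path $r_{\rm add}$, there is $t_0>0$ such that for all $0<t<t_0$ and all choices of $R,R',R'',\tau,\Phi_j,s,r_0^{\pm}$ as above there is a point $\tilde a\in (F_{j,\rm trop}\cap U_j)\setminus U_j'$ at which the singular fiber is well-defined, and a continuous map $$H:\Gamma_{a,\rm total}\times[0,1]\to Y^t_j$$ with $H(\cdot,0)$ the identity of $\Gamma_{a,\rm total}$ (so $H(\Gamma_{a,\rm total}\times\{0\})=\Gamma_{a,\rm total}$) and $H(\Gamma_{a,\rm total}\times\{1\})=SF_{\tilde a,e}$. -/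

import Mathlib

open scoped ContDiff

noncomputable section

namespace HV

/-- Points `(z, u, v)` of `ℂⁿ × ℂ²`. -/
abbrev Pt (n : ℕ) : Type := (Fin n → ℂ) × ℂ × ℂ

/-- An integer vector seen as a real vector. -/
def ivec {n : ℕ} (m : Fin n → ℤ) : Fin n → ℝ := fun i => (m i : ℝ)

/-- The pairing `⟨m, x⟩`. -/
def pair {n : ℕ} (m : Fin n → ℤ) (x : Fin n → ℝ) : ℝ := ∑ i, (m i : ℝ) * x i

/-- The Laurent monomial `z^m`. -/
def monom {n : ℕ} (m : Fin n → ℤ) (z : Fin n → ℂ) : ℂ := ∏ i, z i ^ m i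

/-- The rescaled logarithm map `Log_t`. -/
def Logt {n : ℕ} (t : ℝ) (z : Fin n → ℂ) : Fin n → ℝ :=
  fun i => Real.log ‖z i‖ / Real.log t

/-- The positive real point `s_{real>0}(x)` of `Log_t⁻¹(x)`. -/
def sreal {n : ℕ} (t : ℝ) (x : Fin n → ℝ) : Fin n → ℂ := fun i => ((t ^ x i : ℝ) : ℂ)

/-- `exp(√-1 arg c)` for `c ≠ 0`. -/
def phase (c : ℂ) : ℂ := c / (‖c‖ : ℂ)

/-- The cycle `σ(s)` in `(ℂ*)ⁿ`: the image of `σ` under `m ↦ exp(2π√-1 m) · s`. -/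
def cyc {n : ℕ} (σ : Set (Fin n → ℝ)) (s : Fin n → ℂ) : Set (Fin n → ℂ) :=
  {z | ∃ m ∈ σ, z = fun i => Complex.exp (2 * Real.pi * Complex.I * (m i : ℂ)) * s i}

/-! ### The potential and the tropical polytope -/

/-- Exponents `v_k` and weights `λ_k` of the potential `1 + ∑ t^{λ_k} z^{v_k}`. -/
structure Potential (n p : ℕ) where
  v : Fin p → Fin n → ℤ
  lam : Fin p → ℝ

/-- The term `t^{λ_k} z^{v_k}`. -/
def Potential.term {n p : ℕ} (P : Potential n p) (t : ℝ) (k : Fin p) (z : Fin n → ℂ) : ℂ :=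
  ((t ^ P.lam k : ℝ) : ℂ) * monom (P.v k) z

/-- `W_Σ(z)`. -/
def Potential.W {n p : ℕ} (P : Potential n p) (t : ℝ) (z : Fin n → ℂ) : ℂ :=
  1 + ∑ k, P.term t k z

/-- `χ_k(x) = λ_k + ⟨v_k, x⟩`. -/
def Potential.chi {n p : ℕ} (P : Potential n p) (k : Fin p) (x : Fin n → ℝ) : ℝ :=
  P.lam k + pair (P.v k) x

/-- The polytope `G_trop`. -/
def Potential.G {n p : ℕ} (P : Potential n p) : Set (Fin n → ℝ) := {x | ∀ k, 0 ≤ P.chi k x}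

/-- The facet `F_{j,trop}`. -/
def Potential.facet {n p : ℕ} (P : Potential n p) (j : Fin p) : Set (Fin n → ℝ) :=
  {x | x ∈ P.G ∧ P.chi j x = 0}

/-- The mirror `Y^t = {uv = W_Σ(z)}` in `(ℂ*)ⁿ × ℂ²`. -/
def Potential.Yt {n p : ℕ} (P : Potential n p) (t : ℝ) : Set (Pt n) :=
  {q | (∀ i, q.1 i ≠ 0) ∧ q.2.1 * q.2.2 = P.W t q.1}

/-- The condition `μ₀(q) ∈ [0,R]² × (log t · U)`. -/
def inBox {n : ℕ} (t R : ℝ) (U : Set (Fin n → ℝ)) (q : Pt n) : Prop :=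
  ‖q.2.1‖ ^ 2 / 2 ≤ R ∧ ‖q.2.2‖ ^ 2 / 2 ≤ R ∧ Logt t q.1 ∈ U

/-! ### The deformation near a facet -/

/-- The open sets `U_j'' ⊂⊂ U_j' ⊂⊂ U_j` around a part of the facet `F_{j,trop}`, with the constants
`c_k`, and the cut-off function `ρ_j` (so that `ρ_{j,t} = ρ_j ∘ Log_t`), which does not vary in the
direction `v_j` close to the facet. -/
structure FacetNbhd {n p : ℕ} (P : Potential n p) (j : Fin p) where
  U : Set (Fin n → ℝ)
  U' : Set (Fin n → ℝ)
  U'' : Set (Fin n → ℝ)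
  c : Fin p → ℝ
  rho : (Fin n → ℝ) → ℝ
  isOpen_U : IsOpen U
  isOpen_U' : IsOpen U'
  isOpen_U'' : IsOpen U''
  convex_U : Convex ℝ U
  compact_U' : IsCompact (closure U')
  closure_U' : closure U' ⊆ U
  compact_U'' : IsCompact (closure U'')
  closure_U'' : closure U'' ⊆ U'
  meets_facet : (U'' ∩ P.facet j).Nonempty
  c_pos : 0 < c j
  c_lt : ∀ k, k ≠ j → c j < c k
  chi_lt : ∀ x ∈ U, P.chi j x < c j
  lt_chi : ∀ x ∈ U, ∀ k, k ≠ j → c k < P.chi k x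
  rho_smooth : ContDiff ℝ ∞ rho
  rho_mem : ∀ x, rho x ∈ Set.Icc (0 : ℝ) 1
  rho_one : ∀ x ∈ U'', rho x = 1
  rho_zero : ∀ x, x ∉ U' → rho x = 0
  rho_const : ∃ ε > 0, ∀ x ∈ U ∩ P.facet j, ∀ s : ℝ, |s| < ε →
    rho (x + s • ivec (P.v j)) = rho x

/-- `W_{Σ,j}(z) = W_Σ(z) - ρ_{j,t}(z) ∑_{k ≠ j} t^{λ_k} z^{v_k}` -/
def FacetNbhd.Wj {n p : ℕ} {P : Potential n p} {j : Fin p} (N : FacetNbhd P j) (t : ℝ)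
    (z : Fin n → ℂ) : ℂ :=
  P.W t z - (N.rho (Logt t z) : ℂ) * ∑ k ∈ Finset.univ.erase j, P.term t k z

/-- `Y^t_j = Y^t ∩ μ₀⁻¹([0,R]² × (log t · U_j))` -/
def FacetNbhd.Yj {n p : ℕ} {P : Potential n p} {j : Fin p} (N : FacetNbhd P j) (t R : ℝ) :
    Set (Pt n) :=
  {q | q ∈ P.Yt t ∧ inBox t R N.U q}

/-- `Y^t_{j,simple}`, given by
`uv = W_Σ(z) - τ(u,v) ρ_{j,t}(z) ∑_{k ≠ j} t^{λ_k} z^{v_k}` in the same region. -/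
def FacetNbhd.Ysimple {n p : ℕ} {P : Potential n p} {j : Fin p} (N : FacetNbhd P j) (t R : ℝ)
    (tau : ℂ × ℂ → ℝ) : Set (Pt n) :=
  {q | (∀ i, q.1 i ≠ 0) ∧
    q.2.1 * q.2.2 = P.W t q.1 - (tau q.2 : ℂ) * (N.rho (Logt t q.1) : ℂ) *
      ∑ k ∈ Finset.univ.erase j, P.term t k q.1 ∧
    inBox t R N.U q}

/-- The form `ω₀ = ∑ dz_i ∧ dz̄_i / |z_i|² + du ∧ dū + dv ∧ dv̄` at `q`. -/
def omega0 {n : ℕ} (q ξ ζ : Pt n) : ℂ :=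
  (∑ i, (ξ.1 i * star (ζ.1 i) - ζ.1 i * star (ξ.1 i)) / ((‖q.1 i‖ ^ 2 : ℝ) : ℂ)) +
    (ξ.2.1 * star ζ.2.1 - ζ.2.1 * star ξ.2.1) + (ξ.2.2 * star ζ.2.2 - ζ.2.2 * star ξ.2.2)

/-- `Φ` restricts to a diffeomorphism `A → B` of submanifolds (with corners) of `ℂⁿ × ℂ²` which
matches the restrictions of `ω₀` to `A` and `B`. -/
structure IsSymplectomorphism {n : ℕ} (A B : Set (Pt n)) (Φ : Pt n → Pt n) : Prop where
  bijOn : Set.BijOn Φ A B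
  smooth : ContDiffOn ℝ ∞ Φ A
  smooth_inv : ∃ Ψ : Pt n → Pt n, ContDiffOn ℝ ∞ Ψ B ∧ Set.InvOn Ψ Φ A B
  preserves : ∀ q ∈ A, ∃ L : Pt n →L[ℝ] Pt n, HasFDerivWithinAt Φ L A q ∧
    ∀ ξ ∈ tangentConeAt ℝ A q, ∀ ζ ∈ tangentConeAt ℝ A q,
      omega0 (Φ q) (L ξ) (L ζ) = omega0 q ξ ζ

/-- Radii `R > R' > R''`, the cut-off function `τ(u,v)` and the symplectomorphism
`Φ_j : Y^t_j → Y^t_{j,simple}`. -/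
structure Deformation {n p : ℕ} {P : Potential n p} {j : Fin p} (N : FacetNbhd P j)
    (t : ℝ) where
  R : ℝ
  R' : ℝ
  R'' : ℝ
  R'_lt : R' < R
  R''_lt : R'' < R'
  one_lt : 1 < R''
  bound : ∀ z : Fin n → ℂ, (∀ i, z i ≠ 0) → Logt t z ∈ N.U →
    (1 + ∑ k, ‖P.term t k z‖) / 2 < R''
  tau : ℂ × ℂ → ℝ
  tau_smooth : ContDiff ℝ ∞ tau
  tau_mem : ∀ w, tau w ∈ Set.Icc (0 : ℝ) 1
  tau_one : ∀ w : ℂ × ℂ, ‖w.1‖ ^ 2 / 2 ≤ R'' → ‖w.2‖ ^ 2 / 2 ≤ R'' → tau w = 1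
  tau_zero : ∀ w : ℂ × ℂ, ¬ (‖w.1‖ ^ 2 / 2 ≤ R' ∧ ‖w.2‖ ^ 2 / 2 ≤ R') → tau w = 0
  Phi : Pt n → Pt n
  symplecto : IsSymplectomorphism (N.Yj t R) (N.Ysimple t R tau) Phi
  eq_id : ∀ q ∈ N.Yj t R, ¬ inBox t R' N.U' q → Phi q = q

/-! ### The tropical curve and its ends -/

/-- A tropical (max-plus) Laurent polynomial `⊕_m coeff(m) ⊙ ⟨m, x⟩`. -/
structure TropPoly (n : ℕ) where
  supp : Finset (Fin n → ℤ)
  nonempty : supp.Nonempty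
  coeff : (Fin n → ℤ) → ℝ

def TropPoly.eval {n : ℕ} (f : TropPoly n) (x : Fin n → ℝ) : ℝ :=
  f.supp.sup' f.nonempty fun m => f.coeff m + pair m x

/-- The monomials attaining the maximum at `x`. -/
def TropPoly.leading {n : ℕ} (f : TropPoly n) (x : Fin n → ℝ) : Set (Fin n → ℤ) :=
  {m | m ∈ f.supp ∧ f.coeff m + pair m x = f.eval x}

/-- The cell, dual to `x`, of the subdivision of the Newton polytope. -/
def TropPoly.cell {n : ℕ} (f : TropPoly n) (x : Fin n → ℝ) : Set (Fin n → ℝ) :=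
  convexHull ℝ (ivec '' f.leading x)

/-- The tropical hypersurface `V(f)`: the maximum is attained at least twice. -/
def TropPoly.hypersurface {n : ℕ} (f : TropPoly n) : Set (Fin n → ℝ) :=
  {x | (f.leading x).Nontrivial}

/-- The tropical curve `β_{trop,C}`: the intersection of the `n - 1` tropical hypersurfaces
`V(f_k)`, cut off at the boundary of `G_trop`. -/
def tropCurve {n p : ℕ} (P : Potential n p) (f : Fin (n - 1) → TropPoly n) :
    Set (Fin n → ℝ) :=
  {x | x ∈ P.G ∧ ∀ k, x ∈ (f k).hypersurface}

/-- An end `a ∈ U_j ∩ F_{j,trop}` of an edge `e` of the tropical curve. The edge is dual to the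
`(n-1)`-dimensional cell `σ_e = ∑_k [q_k, q'_k]`, the `k`-th segment being a 1-cell of the
subdivision defined by `f_k`. The segment `β_a` from `a + ℓ v_j ∈ U_j ∖ U_j'` to `a` lies on `e`
and in `U_j`. -/
structure EdgeEnd {n p : ℕ} {P : Potential n p} {j : Fin p} (N : FacetNbhd P j)
    (f : Fin (n - 1) → TropPoly n) where
  a : Fin n → ℝ
  a_mem : a ∈ N.U ∩ P.facet j
  q : Fin (n - 1) → Fin n → ℤ
  q' : Fin (n - 1) → Fin n → ℤ
  indep : LinearIndependent ℝ fun k => ivec (q' k - q k)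
  len : ℝ
  len_pos : 0 < len
  edge : ∀ s ∈ Set.Icc 0 len, a + s • ivec (P.v j) ∈ tropCurve P f ∧
    ∀ k, (f k).cell (a + s • ivec (P.v j)) = segment ℝ (ivec (q k)) (ivec (q' k))
  mem_U : ∀ s ∈ Set.Icc 0 len, a + s • ivec (P.v j) ∈ N.U
  start_notMem : a + len • ivec (P.v j) ∉ N.U'

namespace EdgeEnd

variable {n p : ℕ} {P : Potential n p} {j : Fin p} {N : FacetNbhd P j}
  {f : Fin (n - 1) → TropPoly n}

/-- The integral vectors `ξ_a^{⊥,k}`. -/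
def xi (e : EdgeEnd N f) (k : Fin (n - 1)) : Fin n → ℤ := e.q' k - e.q k

/-- The cell `σ_e`, a Minkowski sum of segments. -/
def sigma (e : EdgeEnd N f) : Set (Fin n → ℝ) :=
  {x | ∃ h : Fin (n - 1) → ℝ, (∀ k, h k ∈ Set.Icc (0 : ℝ) 1) ∧
    x = ∑ k, (ivec (e.q k) + h k • ivec (e.xi k))}

/-- The path `r_a` along `β_a`, with `r_a(1) = a`. -/
def ra (e : EdgeEnd N f) (τ : ℝ) : Fin n → ℝ := e.a + ((1 - τ) * e.len) • ivec (P.v j)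

/-- The cell `σ̃_a = σ_e + [0, γ_a]`. -/
def sigmaTilde (e : EdgeEnd N f) (γ : Fin n → ℤ) : Set (Fin n → ℝ) :=
  {x | ∃ m ∈ e.sigma, ∃ h ∈ Set.Icc (0 : ℝ) 1, x = m + h • ivec γ}

/-- The requirements on the path `r_add` that do not involve `t`. -/
structure IsAddPath (e : EdgeEnd N f) (r : ℝ → Fin n → ℝ) : Prop where
  cont : ContinuousOn r (Set.Icc 0 1)
  mem_U : ∀ τ ∈ Set.Icc (0 : ℝ) 1, r τ ∈ N.U
  notMem_U' : ∀ τ ∈ Set.Icc (0 : ℝ) 1, r τ ∉ N.U'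
  half : r (1 / 2) = e.ra 0

/-- The path `s(r_a(τ)) ∈ Log_t⁻¹(r_a(τ))`: it starts at the positive real point, ends at a zero of
`1 + t^{λ_j} z^{v_j}`, and the phase of `s^{v_j}` runs counterclockwise from `1` to `-1`. -/
structure IsLift (e : EdgeEnd N f) (t : ℝ) (s : ℝ → Fin n → ℂ) : Prop where
  cont : ContinuousOn s (Set.Icc 0 1)
  ne_zero : ∀ τ ∈ Set.Icc (0 : ℝ) 1, ∀ i, s τ i ≠ 0
  log_eq : ∀ τ ∈ Set.Icc (0 : ℝ) 1, Logt t (s τ) = e.ra τ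
  start : s 0 = sreal t (e.ra 0)
  finish : 1 + P.term t j (s 1) = 0
  angle : ∃ φ : ℝ → ℝ, ContinuousOn φ (Set.Icc 0 1) ∧ MonotoneOn φ (Set.Icc 0 1) ∧
    φ 0 = 0 ∧ φ 1 = Real.pi ∧ ∀ τ ∈ Set.Icc (0 : ℝ) 1,
      phase (monom (P.v j) (s τ)) = Complex.exp (Complex.I * (φ τ : ℂ))

/-- The chain `Γ_a = Φ_j^*{z ∈ σ_a(s(r_a(τ))), |u| = |v|}`. -/
def GammaA (e : EdgeEnd N f) {t : ℝ} (D : Deformation N t) (s : ℝ → Fin n → ℂ) : Set (Pt n) :=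
  {x | x ∈ N.Yj t D.R ∧ ∃ y ∈ N.Ysimple t D.R D.tau, D.Phi x = y ∧ ‖y.2.1‖ = ‖y.2.2‖ ∧
    ∃ τ ∈ Set.Icc (0 : ℝ) 1, y.1 ∈ cyc e.sigma (s τ)}

/-- The data from which `Γ_add` is built: the vector `γ_a`, the path `r_add` and the radii `r_0^±`. -/
structure AddData (n : ℕ) where
  γ : Fin n → ℤ
  r : ℝ → Fin n → ℝ
  rp : ℝ → ℝ
  rm : ℝ → ℝ

/-- The requirements on the data of `Γ_add` at the parameter `t`. -/
structure IsAdmissible (N : FacetNbhd P j) (t : ℝ) (A : AddData n) : Prop where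
  inner : ∀ k, k ≠ j → t ^ P.chi j (A.r 0) + ((p : ℝ) - 1) * t ^ N.c k < 1
  outer : ∀ k, k ≠ j → 1 + ((p : ℝ) - 1) * t ^ N.c k < t ^ P.chi j (A.r 1)
  rp_cont : ContinuousOn A.rp (Set.Icc 0 1)
  rm_cont : ContinuousOn A.rm (Set.Icc 0 1)
  rp_pos : ∀ τ ∈ Set.Icc (0 : ℝ) 1, 0 < A.rp τ
  rm_pos : ∀ τ ∈ Set.Icc (0 : ℝ) 1, 0 < A.rm τ
  at_zero : 2 * √(A.rp 0 * A.rm 0) = ‖P.W t (sreal t (A.r 0))‖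
  at_one : 2 * √(A.rp 1 * A.rm 1) = ‖P.W t (sreal t (A.r 1))‖

/-- `σ̃_a(τ)` -/
def tildeAt (e : EdgeEnd N f) (t : ℝ) (A : AddData n) (τ : ℝ) : Set (Fin n → ℂ) :=
  cyc (e.sigmaTilde A.γ) (sreal t (A.r τ))

/-- `Γ^{+,part1}` -/
def GammaPlus1 (e : EdgeEnd N f) (t : ℝ) (A : AddData n) : Set (Pt n) :=
  {x | x ∈ P.Yt t ∧ ∃ τ ∈ Set.Icc (0 : ℝ) (1 / 2),
    x.1 ∈ e.tildeAt t A τ ∧ x.2.1 = (√(2 * A.rp τ) : ℂ)}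

/-- `Γ_av`. On `σ̃_a = σ_e + η_a γ_a`, `η_a ∈ [0,1]`, the angle `arg(z^{v_j}) ∈ [0,2π]` is
`2π η_a`. -/
def GammaAv (e : EdgeEnd N f) (t : ℝ) (A : AddData n) : Set (Pt n) :=
  {x | x ∈ P.Yt t ∧ ∃ m ∈ e.sigma, ∃ h ∈ Set.Icc (0 : ℝ) 1, ∃ s ∈ Set.Icc (0 : ℝ) 1,
    x.1 ∈ cyc {m + h • ivec A.γ} (sreal t (A.r (1 / 2))) ∧
    x.2.1 = Complex.exp (Complex.I * (s * (2 * Real.pi * h) : ℝ)) * (√(2 * A.rp (1 / 2)) : ℂ)}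

/-- `Γ^{+,part2}` -/
def GammaPlus2 (e : EdgeEnd N f) (t : ℝ) (A : AddData n) : Set (Pt n) :=
  {x | x ∈ P.Yt t ∧ ∃ τ ∈ Set.Icc (1 / 2 : ℝ) 1, x.1 ∈ e.tildeAt t A τ ∧
    x.2.1 = phase (monom (P.v j) x.1) * (√(2 * A.rp τ) : ℂ)}

/-- `Γ^-` -/
def GammaMinus (e : EdgeEnd N f) (t : ℝ) (A : AddData n) : Set (Pt n) :=
  {x | x ∈ P.Yt t ∧ ∃ τ ∈ Set.Icc (0 : ℝ) 1,
    x.1 ∈ e.tildeAt t A τ ∧ x.2.2 = (√(2 * A.rm τ) : ℂ)}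

/-- `Γ_out` -/
def GammaOut (e : EdgeEnd N f) (t : ℝ) (A : AddData n) : Set (Pt n) :=
  {x | x ∈ P.Yt t ∧ x.1 ∈ e.tildeAt t A 1 ∧ ∃ μ ∈ Set.Icc (0 : ℝ) 1,
    x.2.2 = phase (((μ : ℂ) * P.W t x.1 + (1 - μ : ℂ) * P.term t j x.1) / monom (P.v j) x.1) *
      (((‖P.W t x.1‖ / ‖P.W t (sreal t (A.r 1))‖) ^ μ * √(2 * A.rm 1) : ℝ) : ℂ)}

/-- `Γ_in` -/
def GammaIn (e : EdgeEnd N f) (t : ℝ) (A : AddData n) : Set (Pt n) :=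
  {x | x ∈ P.Yt t ∧ x.1 ∈ e.tildeAt t A 0 ∧ ∃ μ ∈ Set.Icc (0 : ℝ) 1,
    x.2.1 = phase ((μ : ℂ) * P.W t x.1 + (1 - μ : ℂ)) *
      (((‖P.W t x.1‖ / ‖P.W t (sreal t (A.r 0))‖) ^ μ * √(2 * A.rp 0) : ℝ) : ℂ)}

/-- `Γ_co` -/
def GammaCo (e : EdgeEnd N f) (t : ℝ) (A : AddData n) : Set (Pt n) :=
  {x | x ∈ P.Yt t ∧ x.1 ∈ cyc e.sigma (sreal t (A.r (1 / 2))) ∧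
    ∃ μ ∈ Set.Icc (0 : ℝ) 1, ∃ θ ∈ Set.Icc (0 : ℝ) (2 * Real.pi),
    x.2.1 = ((μ * √‖P.W t x.1‖ + (1 - μ) * √(2 * A.rp (1 / 2)) : ℝ) : ℂ) *
      Complex.exp (Complex.I * (θ : ℂ))}

/-- `Γ_add`, the union of the seven pieces. -/
def GammaAdd (e : EdgeEnd N f) (t : ℝ) (A : AddData n) : Set (Pt n) :=
  e.GammaPlus1 t A ∪ e.GammaAv t A ∪ e.GammaPlus2 t A ∪ e.GammaMinus t A ∪ e.GammaIn t A ∪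
    e.GammaOut t A ∪ e.GammaCo t A

/-- `Γ_{a,total} = Γ_a ∪ Γ_add` -/
def GammaTotal (e : EdgeEnd N f) {t : ℝ} (D : Deformation N t) (s : ℝ → Fin n → ℂ)
    (A : AddData n) : Set (Pt n) :=
  e.GammaA D s ∪ e.GammaAdd t A

/-- `exp(log t (x + τ v_j) + √-1 (α γ_a + ∑_k η_k ξ_a^{⊥,k}))` -/
def zpt (e : EdgeEnd N f) (t : ℝ) (γ : Fin n → ℤ) (x : Fin n → ℝ) (τ α : ℝ)
    (η : Fin (n - 1) → ℝ) : Fin n → ℂ :=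
  fun i => Complex.exp ((Real.log t * (x i + τ * P.v j i) : ℝ) +
    Complex.I * (α * γ i + ∑ k, η k * e.xi k i : ℝ))

/-- `(τ, α)` is a solution of `W_{Σ,j} = 0` over the point `x` and the angles `η`, with
`x + τ v_j ∈ U_j`. -/
def IsSol (e : EdgeEnd N f) (t : ℝ) (γ : Fin n → ℤ) (x : Fin n → ℝ) (η : Fin (n - 1) → ℝ)
    (τ α : ℝ) : Prop :=
  x + τ • ivec (P.v j) ∈ N.U ∧ N.Wj t (e.zpt t γ x τ α η) = 0

/-- The solution `(τ_x(η), α_x(η)) ∈ ℝ × ℝ/2πℤ` exists and is unique for all `η`, so that the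
singular fiber at `x` makes sense. -/
def HasSingularFiber (e : EdgeEnd N f) (t : ℝ) (γ : Fin n → ℤ) (x : Fin n → ℝ) : Prop :=
  ∀ η : Fin (n - 1) → ℝ, (∀ k, η k ∈ Set.Icc 0 (2 * Real.pi)) →
    ∃! w : ℝ × ℝ, w.2 ∈ Set.Ico 0 (2 * Real.pi) ∧ e.IsSol t γ x η w.1 w.2

/-- The singular fiber `SF_{x,e}`. -/
def SF (e : EdgeEnd N f) (t : ℝ) (γ : Fin n → ℤ) (x : Fin n → ℝ) : Set (Pt n) :=
  {y | ∃ η : Fin (n - 1) → ℝ, (∀ k, η k ∈ Set.Icc 0 (2 * Real.pi)) ∧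
    ∃ ηa ∈ Set.Icc 0 (2 * Real.pi), ∃ θ ∈ Set.Icc 0 (2 * Real.pi),
    ∃ τ α : ℝ, α ∈ Set.Ico 0 (2 * Real.pi) ∧ e.IsSol t γ x η τ α ∧
      y.1 = e.zpt t γ x τ (α + ηa) η ∧
      y.2.1 = (√‖N.Wj t y.1‖ : ℂ) * Complex.exp (Complex.I * (θ : ℂ)) ∧
      y.2.2 = N.Wj t y.1 * ((√‖N.Wj t y.1‖)⁻¹ : ℂ) * Complex.exp (-(Complex.I * (θ : ℂ)))}

end EdgeEnd

end HV

end

/-!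
Fix a point `a` of the facet `χ_j = 0` in `U` but outside `U'`, and let `ℝ × S¹` act on `(ℂ*)ⁿ` by
moving `Log_t` along `v_j` and rotating along `γ`. On an orbit the term `t ^ λ_j z ^ v_j` takes each
nonzero value exactly once, while over `U` the `k`-th of the other terms of `W` is smaller than
`t ^ c_k`. So `W = 0` is there a small perturbation of `1 + t ^ λ_j z ^ v_j = 0`, and a contraction
argument gives a single zero, depending continuously on the orbit. As `v_j` is orthogonal to every
`ξ_k`, the orbits over a fixed `x` are indexed by the angles along `ξ_1, …, ξ_{n-1}`.

The deformation has two stages. First `z` and the phases of `u` and `v` are fixed and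
`|u|² - |v|²` is scaled down to zero, keeping `uv = W(z)`. Then every orbit is moved to the orbit
over `a` with the same angles, its zero of `W` going to the zero there, and the radial coordinate
relative to the zero is contracted, so that every point ends up on the circle of `SF_{a,e}` through
the zero. The phase of `u` is undefined where `u = 0`, that is, where `W = 0`; the second stage is
continuous there because it carries zeros of `W` to zeros of `W`.

This gives a map into `SF_{a,e}`. To make it onto, the angle relative to the zero and the phase of
`u` are twisted during the second stage by homotopies of the identity of the circle which stretch an
arc over the whole circle. Then `Γ_av` alone covers `SF_{a,e}`, since it contains points with every
phase of `z ^ v_j` in `[π, 2π]` and, independently, every phase of `u` in `[0, π]`.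
-/

noncomputable section

namespace HV

/-! ### Convexity, connectedness and homotopies -/

lemma nonempty_inter_frontier_of_isPreconnected {X : Type*} [TopologicalSpace X] {s U : Set X}
    (hs : IsPreconnected s) (hU : (s ∩ U).Nonempty) (hs' : (s \ U).Nonempty) :
    (s ∩ frontier U).Nonempty := by
  by_contra hempty
  rw [Set.not_nonempty_iff_eq_empty, ← Set.disjoint_iff_inter_eq_empty] at hempty
  have hmem {x : X} (hx : x ∈ s) : x ∈ interior U ↔ x ∈ U :=
    ⟨fun h => interior_subset h, fun h => by_contra fun hint =>
      Set.disjoint_left.1 hempty hx ⟨subset_closure h, hint⟩⟩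
  obtain ⟨x, hx, hxU⟩ := hU
  obtain ⟨y, hy, hyU⟩ := hs'
  have hyU' : y ∉ closure U := fun h =>
    Set.disjoint_left.1 hempty hy ⟨h, mt (hmem hy).1 hyU⟩
  obtain ⟨z, -, hz, hz'⟩ := hs (interior U) (closure U)ᶜ isOpen_interior
    isClosed_closure.isOpen_compl
    (fun z hz => or_iff_not_imp_left.2 fun hint hcl => Set.disjoint_left.1 hempty hz ⟨hcl, hint⟩)
    ⟨x, hx, (hmem hx).2 hxU⟩ ⟨y, hy, hyU'⟩
  exact hz' (interior_subset_closure hz)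

lemma exists_isCompact_convex_between {E : Type*} [NormedAddCommGroup E] [NormedSpace ℝ E]
    [FiniteDimensional ℝ E] {K U : Set E} (hK : IsCompact K) (hU : IsOpen U)
    (hconvex : Convex ℝ U) (hKU : K ⊆ U) :
    ∃ L, IsCompact L ∧ Convex ℝ L ∧ K ⊆ L ∧ L ⊆ U := by
  suffices h : ∃ s : Set E, s.Finite ∧ K ⊆ convexHull ℝ s ∧ s ⊆ U by
    obtain ⟨s, hs, hK, hsU⟩ := h
    exact ⟨_, hs.isCompact_convexHull (𝕜 := ℝ), convex_convexHull ℝ s, hK,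
      convexHull_min hsU hconvex⟩
  refine hK.induction_on (p := fun K => ∃ s : Set E, s.Finite ∧ K ⊆ convexHull ℝ s ∧ s ⊆ U)
    ⟨∅, Set.finite_empty, Set.empty_subset _, Set.empty_subset _⟩
    (fun K K' hle ⟨s, hs, hK, hsU⟩ => ⟨s, hs, hle.trans hK, hsU⟩) ?_ fun x hx => ?_
  · rintro K K' ⟨s, hs, hK, hsU⟩ ⟨s', hs', hK', hsU'⟩
    exact ⟨s ∪ s', hs.union hs', Set.union_subset
      (hK.trans (convexHull_mono Set.subset_union_left))
      (hK'.trans (convexHull_mono Set.subset_union_right)), Set.union_subset hsU hsU'⟩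
  · obtain ⟨b, hxb, hbU⟩ := exists_mem_interior_convexHull_affineBasis (hU.mem_nhds (hKU hx))
    exact ⟨_, nhdsWithin_le_nhds (mem_interior_iff_mem_nhds.1 hxb), _, Set.finite_range b,
      subset_rfl, (subset_convexHull ℝ _).trans hbU⟩

lemma exists_homotopic_of_continuousOn {X Y : Type*} [TopologicalSpace X] [TopologicalSpace Y]
    {S : Set X} {T : Set Y} {G : ℝ × X → Y} (hG : ContinuousOn G (Set.Icc 0 1 ×ˢ S))
    (hGT : Set.MapsTo G (Set.Icc 0 1 ×ˢ S) T) (f₀ : C(S, T)) (h₀ : ∀ q, (f₀ q : Y) = G (0, q)) :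
    ∃ f₁ : C(S, T), (∀ q, (f₁ q : Y) = G (1, q)) ∧ f₀.Homotopic f₁ := by
  have hmem (w : unitInterval × S) : ((w.1 : ℝ), (w.2 : X)) ∈ Set.Icc (0 : ℝ) 1 ×ˢ S :=
    ⟨w.1.2, w.2.2⟩
  let F : C(unitInterval × S, T) := ⟨fun w => ⟨G (w.1, w.2), hGT (hmem w)⟩,
    (hG.comp_continuous (by fun_prop) hmem).subtype_mk _⟩
  exact ⟨F.comp ⟨fun q => (1, q), by fun_prop⟩, fun _ => rfl,
    ⟨⟨F, fun q => Subtype.ext (h₀ q).symm, fun _ => rfl⟩⟩⟩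

lemma exists_eq_smul_add_sum_smul {K V ι : Type*} [Field K] [AddCommGroup V] [Module K V]
    [FiniteDimensional K V] [Fintype ι] (F : V →ₗ[K] K) {g : V} (hg : F g = 1) {ξ : ι → V}
    (hξ : LinearIndependent K ξ) (hker : ∀ k, F (ξ k) = 0)
    (hcard : Module.finrank K V ≤ Fintype.card ι + 1) (x : V) :
    ∃ η : ι → K, x = F x • g + ∑ k, η k • ξ k := by
  have hle : Submodule.span K (Set.range ξ) ≤ LinearMap.ker F :=
    Submodule.span_le.2 (Set.range_subset_iff.2 hker)
  have hrange : LinearMap.range F = ⊤ :=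
    LinearMap.range_eq_top.2 fun c => ⟨c • g, by rw [map_smul, hg, smul_eq_mul, mul_one]⟩
  have hrank := F.finrank_range_add_finrank_ker
  rw [hrange, finrank_top, Module.finrank_self] at hrank
  have hspan : Submodule.span K (Set.range ξ) = LinearMap.ker F :=
    Submodule.eq_of_le_of_finrank_le hle (by rw [finrank_span_eq_card hξ]; omega)
  have hmem : x - F x • g ∈ LinearMap.ker F := by
    rw [LinearMap.mem_ker, map_sub, map_smul, hg, smul_eq_mul, mul_one, sub_self]
  rw [← hspan, Submodule.mem_span_range_iff_exists_fun] at hmem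
  obtain ⟨η, hη⟩ := hmem
  exact ⟨η, by rw [hη, add_sub_cancel]⟩

lemma left_mem_extremePoints_segment {V : Type*} [AddCommGroup V] [Module ℝ V] (x y : V) :
    x ∈ (segment ℝ x y).extremePoints ℝ := by
  refine mem_extremePoints_iff_left.2 ⟨left_mem_segment _ _ _, ?_⟩
  rintro x₁ hx₁ x₂ hx₂ ⟨α, β, hα, hβ, hαβ, hsum⟩
  rw [segment_eq_image'] at hx₁ hx₂
  obtain ⟨s₁, hs₁, rfl⟩ := hx₁
  obtain ⟨s₂, hs₂, rfl⟩ := hx₂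
  have hcomb : x + (α * s₁ + β * s₂) • (y - x) = x := by
    obtain rfl := eq_sub_of_add_eq hαβ
    refine Eq.trans ?_ hsum
    module
  rcases smul_eq_zero.1 (add_eq_left.1 hcomb) with hs | hxy
  · have hs₁ : s₁ = 0 := by nlinarith [mul_nonneg hα.le hs₁.1, mul_nonneg hβ.le hs₂.1]
    simp only [hs₁, zero_smul, add_zero]
  · simp only [hxy, smul_zero, add_zero]

/-! ### Phases -/

lemma mul_star_of_norm_eq_one {c : ℂ} (hc : ‖c‖ = 1) : c * star c = 1 := by
  rw [Complex.star_def, Complex.mul_conj', hc, Complex.ofReal_one, one_pow]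

lemma phase_zero : phase 0 = 0 := by simp [phase]

lemma norm_phase {c : ℂ} (hc : c ≠ 0) : ‖phase c‖ = 1 := by
  have : ‖c‖ ≠ 0 := norm_ne_zero_iff.2 hc
  simp [phase, this]

lemma phase_ne_zero {c : ℂ} (hc : c ≠ 0) : phase c ≠ 0 := by
  rw [← norm_ne_zero_iff, norm_phase hc]
  exact one_ne_zero

lemma norm_phase_le_one (c : ℂ) : ‖phase c‖ ≤ 1 := by
  rcases eq_or_ne c 0 with rfl | hc
  · simp [phase_zero]
  · exact (norm_phase hc).le

lemma norm_mul_phase (c : ℂ) : (‖c‖ : ℂ) * phase c = c := by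
  rcases eq_or_ne c 0 with rfl | hc
  · simp
  · exact mul_div_cancel₀ c (Complex.ofReal_ne_zero.2 (norm_ne_zero_iff.2 hc))

lemma phase_mul (a b : ℂ) : phase (a * b) = phase a * phase b := by
  simp [phase, mul_div_mul_comm]

lemma phase_ofReal_of_pos {r : ℝ} (hr : 0 < r) : phase (r : ℂ) = 1 := by
  have : (r : ℂ) ≠ 0 := Complex.ofReal_ne_zero.2 hr.ne'
  simp [phase, abs_of_pos hr, this]

lemma phase_of_norm_eq_one {c : ℂ} (hc : ‖c‖ = 1) : phase c = c := by simp [phase, hc]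

lemma exp_I_mul_arg {c : ℂ} (hc : c ≠ 0) : Complex.exp (Complex.I * (c.arg : ℂ)) = phase c := by
  refine mul_left_cancel₀ (Complex.ofReal_ne_zero.2 (norm_ne_zero_iff.2 hc)) ?_
  rw [norm_mul_phase, mul_comm Complex.I, Complex.norm_mul_exp_arg_mul_I]

lemma continuousAt_phase {c : ℂ} (hc : c ≠ 0) : ContinuousAt phase c := by
  have : (‖c‖ : ℂ) ≠ 0 := Complex.ofReal_ne_zero.2 (norm_ne_zero_iff.2 hc)
  unfold phase
  fun_prop (disch := assumption)

lemma continuousWithinAt_mul_of_eq_zero {X : Type*} [TopologicalSpace X] {S : Set X}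
    {f g : X → ℂ} {x : X} (hf : ContinuousWithinAt f S x) (h0 : f x = 0)
    (hg : ∀ y, ‖g y‖ ≤ 1) : ContinuousWithinAt (fun y => f y * g y) S x := by
  have hf0 : Filter.Tendsto f (nhdsWithin x S) (nhds 0) := h0 ▸ hf
  have hle (y : X) : ‖f y * g y‖ ≤ ‖f y‖ :=
    (norm_mul_le _ _).trans (mul_le_of_le_one_right (norm_nonneg _) (hg y))
  have hfg : Filter.Tendsto (fun y => f y * g y) (nhdsWithin x S) (nhds 0) :=
    squeeze_zero_norm hle (by simpa using hf0.norm)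
  simpa [ContinuousWithinAt, h0] using hfg

/-- `√‖c‖ · e^{i arg c}`: the value of `v` when `|u| = |v|`, `uv = c` and `u > 0`. Not a square root
of `c`. -/
def sqrtPhase (c : ℂ) : ℂ := (√‖c‖ : ℂ) * phase c

lemma sqrt_norm_mul_sqrtPhase (c : ℂ) : (√‖c‖ : ℂ) * sqrtPhase c = c := by
  rw [sqrtPhase, ← mul_assoc, ← Complex.ofReal_mul, Real.mul_self_sqrt (norm_nonneg c),
    norm_mul_phase]

lemma norm_sqrtPhase (c : ℂ) : ‖sqrtPhase c‖ = √‖c‖ := by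
  rcases eq_or_ne c 0 with rfl | hc
  · simp [sqrtPhase]
  · rw [sqrtPhase, norm_mul, norm_phase hc, mul_one, Complex.norm_real,
      Real.norm_of_nonneg (Real.sqrt_nonneg _)]

lemma mul_inv_sqrt_norm (c : ℂ) : c * (√‖c‖ : ℂ)⁻¹ = sqrtPhase c := by
  rcases eq_or_ne c 0 with rfl | hc
  · simp [sqrtPhase]
  · have hs : (√‖c‖ : ℂ) ≠ 0 :=
      Complex.ofReal_ne_zero.2 (Real.sqrt_pos.2 (norm_pos_iff.2 hc)).ne'
    rw [mul_inv_eq_iff_eq_mul₀ hs, mul_comm, sqrt_norm_mul_sqrtPhase]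

lemma continuous_sqrtPhase : Continuous sqrtPhase := by
  have hsqrt : Continuous fun c : ℂ => (√‖c‖ : ℂ) := by fun_prop
  refine continuous_iff_continuousAt.2 fun c => ?_
  rcases eq_or_ne c 0 with rfl | hc
  · rw [← continuousWithinAt_univ]
    exact continuousWithinAt_mul_of_eq_zero hsqrt.continuousWithinAt (by simp) norm_phase_le_one
  · exact hsqrt.continuousAt.mul (continuousAt_phase hc)

lemma exp_I_mul_eq_exp_I_mul_iff {α β : ℝ} :
    Complex.exp (Complex.I * (α : ℂ)) = Complex.exp (Complex.I * (β : ℂ)) ↔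
      ∃ m : ℤ, α = β + 2 * Real.pi * m := by
  rw [Complex.exp_eq_exp_iff_exists_int]
  refine exists_congr fun m => ?_
  have hrw : Complex.I * (β : ℂ) + m * (2 * Real.pi * Complex.I) =
      Complex.I * ((β + 2 * Real.pi * m : ℝ) : ℂ) := by
    push_cast
    ring
  rw [hrw, mul_right_inj' Complex.I_ne_zero, Complex.ofReal_inj]

lemma exists_exp_I_mul_eq {c : ℂ} (hc : ‖c‖ = 1) (b : ℝ) :
    ∃ φ ∈ Set.Ico b (b + 2 * Real.pi), Complex.exp (Complex.I * (φ : ℂ)) = c := by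
  have hper : Function.Periodic (fun φ : ℝ => Complex.exp (Complex.I * φ)) (2 * Real.pi) := by
    intro φ
    simpa [mul_comm, mul_left_comm, mul_assoc, mul_add] using
      Complex.exp_periodic (Complex.I * φ)
  obtain ⟨φ, hφ, h⟩ := hper.exists_mem_Ico Real.two_pi_pos c.arg b
  refine ⟨φ, hφ, h.symm.trans ?_⟩
  simpa [hc, mul_comm] using Complex.norm_mul_exp_arg_mul_I c

/-- The map of the circle multiplying angles in `[0, π]` by `1 + s` and angles in `[-π, 0]` by
`1 - s`. It has degree one, so it is homotopic to the identity, yet for `s = 2` it is onto already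
on the upper half circle. -/
def twist (s : ℝ) (c : ℂ) : ℂ := c * Complex.exp (Complex.I * (s * Real.arccos c.re : ℝ))

lemma continuous_twist : Continuous fun w : ℝ × ℂ => twist w.1 w.2 := by
  unfold twist
  have := Real.continuous_arccos
  fun_prop

lemma norm_twist (s : ℝ) (c : ℂ) : ‖twist s c‖ = ‖c‖ := by
  rw [twist, norm_mul, Complex.norm_exp_I_mul_ofReal, mul_one]

lemma twist_zero_left (c : ℂ) : twist 0 c = c := by simp [twist]

lemma twist_one_right (s : ℝ) : twist s 1 = 1 := by simp [twist]

lemma twist_exp_I_mul (s : ℝ) {φ : ℝ} (hφ : φ ∈ Set.Icc 0 Real.pi) :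
    twist s (Complex.exp (Complex.I * (φ : ℂ))) =
      Complex.exp (Complex.I * (((1 + s) * φ : ℝ) : ℂ)) := by
  have hre : (Complex.exp (Complex.I * (φ : ℂ))).re = Real.cos φ := by
    rw [mul_comm, Complex.exp_ofReal_mul_I_re]
  rw [twist, hre, Real.arccos_cos hφ.1 hφ.2, ← Complex.exp_add]
  congr 1
  push_cast
  ring

lemma twist_one_exp_half {θ : ℝ} (hθ : θ ∈ Set.Icc 0 (2 * Real.pi)) :
    twist 1 (Complex.exp (Complex.I * ((θ / 2 : ℝ) : ℂ))) = Complex.exp (Complex.I * (θ : ℂ)) := by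
  rw [twist_exp_I_mul 1 ⟨by linarith [hθ.1], by linarith [hθ.2]⟩]
  congr 3
  ring

lemma exists_twist_two_eq {c : ℂ} (hc : ‖c‖ = 1) :
    ∃ β ∈ Set.Ico (Real.pi / 6) (5 * Real.pi / 6),
      twist 2 (Complex.exp (Complex.I * (β : ℂ))) = c := by
  obtain ⟨φ, ⟨hlo, hhi⟩, rfl⟩ := exists_exp_I_mul_eq hc (Real.pi / 2)
  have hpi := Real.pi_pos
  refine ⟨φ / 3, ⟨by linarith, by linarith⟩, ?_⟩
  rw [twist_exp_I_mul 2 ⟨by linarith, by linarith⟩]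
  congr 3
  ring

/-! ### Moving `(u, v)` to `|u| = |v|` -/

/-- The first coordinate of the point of the hyperbola `{X Y = w², X, Y ≥ 0}` with `X - Y = 2x`. -/
def hyperbolaFst (w x : ℝ) : ℝ := √(x ^ 2 + w ^ 2) + x

lemma abs_le_sqrt_sq_add_sq (w x : ℝ) : |x| ≤ √(x ^ 2 + w ^ 2) :=
  Real.abs_le_sqrt (le_add_of_nonneg_right (sq_nonneg w))

lemma hyperbolaFst_nonneg (w x : ℝ) : 0 ≤ hyperbolaFst w x := by
  linarith [neg_abs_le x, abs_le_sqrt_sq_add_sq w x, hyperbolaFst.eq_1 w x]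

lemma hyperbolaFst_zero_right (w : ℝ) : hyperbolaFst w 0 = |w| := by
  simp [hyperbolaFst, Real.sqrt_sq_eq_abs]

lemma hyperbolaFst_zero_left {x : ℝ} (hx : x ≤ 0) : hyperbolaFst 0 x = 0 := by
  simp [hyperbolaFst, Real.sqrt_sq_eq_abs, abs_of_nonpos hx]

lemma hyperbolaFst_mul_neg (w x : ℝ) : hyperbolaFst w x * hyperbolaFst w (-x) = w ^ 2 := by
  have h := Real.mul_self_sqrt (show 0 ≤ x ^ 2 + w ^ 2 by positivity)
  simp only [hyperbolaFst, neg_sq]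
  linear_combination h

lemma hyperbolaFst_mul_half_sub (a b : ℝ) :
    hyperbolaFst (a * b) ((a ^ 2 - b ^ 2) / 2) = a ^ 2 := by
  have h : ((a ^ 2 - b ^ 2) / 2) ^ 2 + (a * b) ^ 2 = ((a ^ 2 + b ^ 2) / 2) ^ 2 := by ring
  rw [hyperbolaFst, h, Real.sqrt_sq (by positivity)]
  ring

lemma hyperbolaFst_mono (w : ℝ) : Monotone (hyperbolaFst w) := by
  intro x y hxy
  have hlip : √(x ^ 2 + w ^ 2) ≤ √(y ^ 2 + w ^ 2) + (y - x) := by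
    refine Real.sqrt_le_iff.2 ⟨add_nonneg (Real.sqrt_nonneg _) (sub_nonneg.2 hxy), ?_⟩
    have hy := (neg_le_abs y).trans (abs_le_sqrt_sq_add_sq w y)
    nlinarith [Real.sq_sqrt (show 0 ≤ y ^ 2 + w ^ 2 by positivity)]
  unfold hyperbolaFst
  linarith

/-- The coordinate `u` after moving `(u, v)` along the curve on which `u v` and both phases are
constant, so that `|u|² - |v|²` gets multiplied by `1 - s`. -/
def balance (s : ℝ) (u v : ℂ) : ℂ :=
  (√(hyperbolaFst (‖u‖ * ‖v‖) ((1 - s) * ((‖u‖ ^ 2 - ‖v‖ ^ 2) / 2))) : ℂ) * phase u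

lemma balance_zero (u v : ℂ) : balance 0 u v = u := by
  rw [balance, sub_zero, one_mul, hyperbolaFst_mul_half_sub, Real.sqrt_sq (norm_nonneg _),
    norm_mul_phase]

lemma balance_one (u v : ℂ) : balance 1 u v = √‖u * v‖ * phase u := by
  rw [balance, sub_self, zero_mul, hyperbolaFst_zero_right, ← norm_mul, abs_norm]

lemma balance_mul_balance (s : ℝ) (u v : ℂ) : balance s u v * balance s v u = u * v := by
  have hneg : (1 - s) * ((‖v‖ ^ 2 - ‖u‖ ^ 2) / 2) = -((1 - s) * ((‖u‖ ^ 2 - ‖v‖ ^ 2) / 2)) := by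
    ring
  have hsqrt : √(hyperbolaFst (‖u‖ * ‖v‖) ((1 - s) * ((‖u‖ ^ 2 - ‖v‖ ^ 2) / 2))) *
      √(hyperbolaFst (‖v‖ * ‖u‖) ((1 - s) * ((‖v‖ ^ 2 - ‖u‖ ^ 2) / 2))) = ‖u‖ * ‖v‖ := by
    rw [← Real.sqrt_mul (hyperbolaFst_nonneg _ _), hneg, mul_comm ‖v‖, hyperbolaFst_mul_neg,
      Real.sqrt_sq (by positivity)]
  calc balance s u v * balance s v u
      = ((‖u‖ * ‖v‖ : ℝ) : ℂ) * (phase u * phase v) := by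
        rw [← hsqrt, balance, balance]
        push_cast
        ring
    _ = (‖u‖ * phase u) * (‖v‖ * phase v) := by push_cast; ring
    _ = u * v := by rw [norm_mul_phase, norm_mul_phase]

lemma sq_norm_balance_le {s m : ℝ} {u v : ℂ} (hs : s ∈ Set.Icc (0 : ℝ) 1) (hu : ‖u‖ ^ 2 ≤ m)
    (hv : ‖v‖ ^ 2 ≤ m) : ‖balance s u v‖ ^ 2 ≤ m := by
  set x := (‖u‖ ^ 2 - ‖v‖ ^ 2) / 2 with hx
  have hend : hyperbolaFst (‖u‖ * ‖v‖) (max x 0) ≤ m := by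
    rcases max_choice x 0 with h | h <;> rw [h]
    · rwa [hx, hyperbolaFst_mul_half_sub]
    · rw [hyperbolaFst_zero_right, abs_of_nonneg (by positivity)]
      nlinarith [sq_nonneg (‖u‖ - ‖v‖)]
  have hle : (1 - s) * x ≤ max x 0 := by
    nlinarith [hs.1, hs.2, le_max_left x 0, le_max_right x 0]
  have hnorm : ‖balance s u v‖ ≤ √(hyperbolaFst (‖u‖ * ‖v‖) ((1 - s) * x)) := by
    rw [balance, norm_mul, Complex.norm_real, Real.norm_of_nonneg (Real.sqrt_nonneg _)]
    exact mul_le_of_le_one_right (Real.sqrt_nonneg _) (norm_phase_le_one _)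
  calc ‖balance s u v‖ ^ 2 ≤ √(hyperbolaFst (‖u‖ * ‖v‖) ((1 - s) * x)) ^ 2 := by gcongr
    _ = hyperbolaFst (‖u‖ * ‖v‖) ((1 - s) * x) := Real.sq_sqrt (hyperbolaFst_nonneg _ _)
    _ ≤ m := (hyperbolaFst_mono _ hle).trans hend

lemma continuousOn_balance :
    ContinuousOn (fun w : ℝ × ℂ × ℂ => balance w.1 w.2.1 w.2.2) {w | w.1 ≤ 1} := by
  rintro ⟨s, u, v⟩ (hs : s ≤ 1)
  have hmod : Continuous fun w : ℝ × ℂ × ℂ =>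
      (√(hyperbolaFst (‖w.2.1‖ * ‖w.2.2‖)
        ((1 - w.1) * ((‖w.2.1‖ ^ 2 - ‖w.2.2‖ ^ 2) / 2))) : ℂ) := by
    unfold hyperbolaFst
    fun_prop
  rcases eq_or_ne u 0 with rfl | hu
  · refine continuousWithinAt_mul_of_eq_zero hmod.continuousWithinAt ?_
      fun w => norm_phase_le_one _
    have : (1 - s) * ((‖(0 : ℂ)‖ ^ 2 - ‖v‖ ^ 2) / 2) ≤ 0 := by
      rw [norm_zero]
      nlinarith [sq_nonneg ‖v‖]
    simp only [norm_zero, zero_mul] at this ⊢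
    rw [hyperbolaFst_zero_left this, Real.sqrt_zero, Complex.ofReal_zero]
  · refine (hmod.continuousAt.mul ?_).continuousWithinAt
    exact ContinuousAt.comp (f := fun w : ℝ × ℂ × ℂ => w.2.1) (continuousAt_phase hu) (by fun_prop)

/-- The point `(z, u, v)` with `u` and `v` replaced by `balance s u v` and `balance s v u`. -/
def balancePt {n : ℕ} (s : ℝ) (q : Pt n) : Pt n :=
  (q.1, balance s q.2.1 q.2.2, balance s q.2.2 q.2.1)

lemma balancePt_zero {n : ℕ} (q : Pt n) : balancePt 0 q = q := by
  simp only [balancePt, balance_zero]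

lemma continuousOn_balancePt {n : ℕ} :
    ContinuousOn (fun w : ℝ × Pt n => balancePt w.1 w.2) {w | w.1 ≤ 1} := by
  refine ContinuousOn.prodMk (by fun_prop) (ContinuousOn.prodMk ?_ ?_)
  · exact continuousOn_balance.comp (f := fun w : ℝ × Pt n => (w.1, w.2.2.1, w.2.2.2))
      (by fun_prop) fun w hw => hw
  · exact continuousOn_balance.comp (f := fun w : ℝ × Pt n => (w.1, w.2.2.2, w.2.2.1))
      (by fun_prop) fun w hw => hw

/-! ### The torus and its orbits -/

section Torus

variable {n : ℕ}

lemma pair_add (m : Fin n → ℤ) (x y : Fin n → ℝ) : pair m (x + y) = pair m x + pair m y :=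
  dotProduct_add _ x y

lemma pair_smul (m : Fin n → ℤ) (s : ℝ) (x : Fin n → ℝ) : pair m (s • x) = s * pair m x :=
  dotProduct_smul s _ x

lemma pair_ivec (m γ : Fin n → ℤ) : pair m (ivec γ) = ((m ⬝ᵥ γ : ℤ) : ℝ) := by
  simp [pair, ivec, dotProduct]

lemma ivec_injective {n : ℕ} : Function.Injective (ivec (n := n)) :=
  fun _ _ h => funext fun i => Int.cast_injective (congrFun h i)

/-- The squared Euclidean length of an integer vector. -/
def normSq (v : Fin n → ℤ) : ℝ := ((v ⬝ᵥ v : ℤ) : ℝ)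

lemma normSq_pos {v : Fin n → ℤ} (hv : v ≠ 0) : 0 < normSq v :=
  Int.cast_pos.2 <| (Finset.sum_nonneg fun i _ => mul_self_nonneg (v i)).lt_of_ne' <|
    dotProduct_self_eq_zero.not.2 hv

lemma normSq_pos_of_dotProduct_eq_one {v γ : Fin n → ℤ} (h : v ⬝ᵥ γ = 1) : 0 < normSq v :=
  normSq_pos (by rintro rfl; simp at h)

lemma monom_ne_zero (m : Fin n → ℤ) {z : Fin n → ℂ} (hz : ∀ i, z i ≠ 0) : monom m z ≠ 0 :=
  Finset.prod_ne_zero_iff.2 fun i _ => zpow_ne_zero _ (hz i)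

lemma continuousAt_monom (m : Fin n → ℤ) {z : Fin n → ℂ} (hz : ∀ i, z i ≠ 0) :
    ContinuousAt (monom m) z :=
  tendsto_finsetProd _ fun i _ => (continuous_apply i).continuousAt.zpow₀ _ (Or.inl (hz i))

lemma continuousAt_Logt (t : ℝ) {z : Fin n → ℂ} (hz : ∀ i, z i ≠ 0) :
    ContinuousAt (Logt t) z := by
  refine continuousAt_pi.2 fun i => ?_
  have hnorm : ContinuousAt (fun z : Fin n → ℂ => ‖z i‖) z :=
    (continuous_apply i).norm.continuousAt
  exact (hnorm.log (norm_ne_zero_iff.2 (hz i))).div_const _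

/-- The point of `Log_t⁻¹(x)` with angles `θ`. -/
def polar (t : ℝ) (x θ : Fin n → ℝ) : Fin n → ℂ :=
  fun i => Complex.exp ((Real.log t * x i : ℝ) + Complex.I * (θ i : ℝ))

variable {t : ℝ}

lemma Logt_polar (ht : 0 < t) (ht1 : t < 1) (x θ : Fin n → ℝ) : Logt t (polar t x θ) = x := by
  have hlog : Real.log t ≠ 0 := (Real.log_neg ht ht1).ne
  funext i
  simp [Logt, polar, Complex.norm_exp, hlog]

lemma polar_Logt (ht : 0 < t) (ht1 : t < 1) {z : Fin n → ℂ} (hz : ∀ i, z i ≠ 0) :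
    polar t (Logt t z) (fun i => (z i).arg) = z := by
  have hlog : Real.log t ≠ 0 := (Real.log_neg ht ht1).ne
  funext i
  rw [polar, Logt, mul_div_cancel₀ _ hlog, Complex.exp_add, ← Complex.ofReal_exp,
    Real.exp_log (norm_pos_iff.2 (hz i)), mul_comm Complex.I, Complex.norm_mul_exp_arg_mul_I]

lemma polar_add_two_pi (x θ : Fin n → ℝ) (m : Fin n → ℤ) :
    polar t x (θ + (2 * Real.pi) • ivec m) = polar t x θ := by
  funext i
  refine Complex.exp_eq_exp_iff_exists_int.2 ⟨m i, ?_⟩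
  simp only [Pi.add_apply, Pi.smul_apply, ivec, smul_eq_mul]
  push_cast
  ring

lemma monom_polar (ht : 0 < t) (m : Fin n → ℤ) (x θ : Fin n → ℝ) :
    monom m (polar t x θ) = (t ^ pair m x : ℝ) * Complex.exp (Complex.I * (pair m θ : ℝ)) := by
  rw [Real.rpow_def_of_pos ht, Complex.ofReal_exp, ← Complex.exp_add]
  simp only [monom, polar, pair, ← Complex.exp_int_mul, ← Complex.exp_sum]
  congr 1
  push_cast
  rw [Finset.mul_sum, Finset.mul_sum, ← Finset.sum_add_distrib]
  exact Finset.sum_congr rfl fun i _ => by ring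

lemma polar_mem_cyc (ht : 0 < t) (x m : Fin n → ℝ) :
    polar t x ((2 * Real.pi) • m) ∈ cyc {m} (sreal t x) := by
  refine ⟨m, rfl, funext fun i => ?_⟩
  rw [polar, sreal, Real.rpow_def_of_pos ht, Complex.ofReal_exp, ← Complex.exp_add, Pi.smul_apply,
    smul_eq_mul]
  congr 1
  push_cast
  ring

/-- The action of `(r, c) ∈ ℝ × S¹` on `(ℂ*)ⁿ`, moving `Log_t` along `v` and rotating along `γ`. -/
def act (v γ : Fin n → ℤ) (r : ℝ) (c : ℂ) (z : Fin n → ℂ) : Fin n → ℂ :=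
  fun i => z i * ((Real.exp (r * (v i / normSq v)) : ℝ) * c ^ γ i)

variable (v γ : Fin n → ℤ)

lemma act_ne_zero (r : ℝ) {c : ℂ} (hc : c ≠ 0) {z : Fin n → ℂ} (hz : ∀ i, z i ≠ 0) (i : Fin n) :
    act v γ r c z i ≠ 0 :=
  mul_ne_zero (hz i) (mul_ne_zero (Complex.ofReal_ne_zero.2 (Real.exp_ne_zero _))
    (zpow_ne_zero _ hc))

lemma act_act (r r' : ℝ) (c c' : ℂ) (z : Fin n → ℂ) :
    act v γ r c (act v γ r' c' z) = act v γ (r + r') (c * c') z := by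
  funext i
  simp only [act]
  rw [mul_zpow, add_mul, Real.exp_add]
  push_cast
  ring

lemma act_zero_one (z : Fin n → ℂ) : act v γ 0 1 z = z := by
  funext i
  simp [act]

lemma continuousAt_act {X : Type*} [TopologicalSpace X] {r : X → ℝ} {c : X → ℂ}
    {z : X → Fin n → ℂ} {x : X} (hr : ContinuousAt r x) (hc : ContinuousAt c x) (h0 : c x ≠ 0)
    (hz : ContinuousAt z x) : ContinuousAt (fun x => act v γ (r x) (c x) (z x)) x := by
  refine continuousAt_pi.2 fun i => ?_
  have hpow : ContinuousAt (fun x => c x ^ γ i) x := hc.zpow₀ _ (Or.inl h0)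
  exact (continuousAt_pi.1 hz i).mul (ContinuousAt.mul (by fun_prop) hpow)

lemma act_polar (ht : 0 < t) (ht1 : t < 1) (r α : ℝ) (x θ : Fin n → ℝ) :
    act v γ r (Complex.exp (Complex.I * (α : ℂ))) (polar t x θ) =
      polar t (x + (r / Real.log t / normSq v) • ivec v) (θ + α • ivec γ) := by
  have hlog : Real.log t ≠ 0 := (Real.log_neg ht ht1).ne
  funext i
  have hr : Real.log t * (x i + r / Real.log t / normSq v * v i) =
      Real.log t * x i + r * (v i / normSq v) := by field_simp
  simp only [act, polar, Pi.add_apply, Pi.smul_apply, ivec, smul_eq_mul]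
  rw [hr, Complex.ofReal_exp, ← Complex.exp_int_mul, ← Complex.exp_add, ← Complex.exp_add]
  congr 1
  push_cast
  ring

lemma Logt_act (ht : 0 < t) (ht1 : t < 1) (r : ℝ) {c : ℂ} (hc : ‖c‖ = 1) {z : Fin n → ℂ}
    (hz : ∀ i, z i ≠ 0) :
    Logt t (act v γ r c z) = Logt t z + (r / Real.log t / normSq v) • ivec v := by
  obtain ⟨α, -, rfl⟩ := exists_exp_I_mul_eq hc 0
  rw [← polar_Logt ht ht1 hz, act_polar v γ ht ht1, Logt_polar ht ht1, Logt_polar ht ht1]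

/-- The action of `w ∈ ℂ`, with real part along `v` and imaginary part along `γ`; since `2πi` acts
trivially it factors through the action of `ℝ × S¹`. -/
def actC (w : ℂ) (z : Fin n → ℂ) : Fin n → ℂ :=
  act v γ w.re (Complex.exp (Complex.I * (w.im : ℂ))) z

lemma actC_ne_zero (w : ℂ) {z : Fin n → ℂ} (hz : ∀ i, z i ≠ 0) (i : Fin n) :
    actC v γ w z i ≠ 0 :=
  act_ne_zero _ _ _ (Complex.exp_ne_zero _) hz i

/-- Moving `Log_t z` to `(1 - s) Log_t z + s a`, with the angles fixed. -/
def slide (t : ℝ) (a : Fin n → ℝ) (s : ℝ) (z : Fin n → ℂ) : Fin n → ℂ :=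
  fun i => z i * Complex.exp ((Real.log t * (s * (a i - Logt t z i)) : ℝ) : ℂ)

variable (a : Fin n → ℝ)

lemma slide_ne_zero (s : ℝ) {z : Fin n → ℂ} (hz : ∀ i, z i ≠ 0) (i : Fin n) :
    slide t a s z i ≠ 0 :=
  mul_ne_zero (hz i) (Complex.exp_ne_zero _)

lemma slide_zero (z : Fin n → ℂ) : slide t a 0 z = z := by
  funext i
  simp [slide]

lemma continuousAt_slide (s : ℝ) {z : Fin n → ℂ} (hz : ∀ i, z i ≠ 0) :
    ContinuousAt (fun w : ℝ × (Fin n → ℂ) => slide t a w.1 w.2) (s, z) := by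
  refine continuousAt_pi.2 fun i => ?_
  have hLog : ContinuousAt (fun w : ℝ × (Fin n → ℂ) => Logt t w.2 i) (s, z) :=
    ContinuousAt.comp (g := fun z : Fin n → ℂ => Logt t z i)
      (continuousAt_pi.1 (continuousAt_Logt t hz) i) continuousAt_snd
  exact ContinuousAt.mul (by fun_prop) (by fun_prop)

lemma slide_polar (ht : 0 < t) (ht1 : t < 1) (s : ℝ) (x θ : Fin n → ℝ) :
    slide t a s (polar t x θ) = polar t ((1 - s) • x + s • a) θ := by
  funext i
  rw [slide, Logt_polar ht ht1, polar, polar, ← Complex.exp_add]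
  congr 1
  simp only [Pi.add_apply, Pi.smul_apply, smul_eq_mul]
  push_cast
  ring

lemma Logt_slide (ht : 0 < t) (ht1 : t < 1) (s : ℝ) {z : Fin n → ℂ} (hz : ∀ i, z i ≠ 0) :
    Logt t (slide t a s z) = (1 - s) • Logt t z + s • a := by
  rw [← polar_Logt ht ht1 hz, slide_polar a ht ht1, Logt_polar ht ht1, Logt_polar ht ht1]

lemma Logt_eq_of_mem_cyc {n : ℕ} {t : ℝ} {σ : Set (Fin n → ℝ)} {s z : Fin n → ℂ}
    (hz : z ∈ cyc σ s) : Logt t z = Logt t s := by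
  obtain ⟨m, -, rfl⟩ := hz
  have hnorm (i : Fin n) : ‖Complex.exp (2 * Real.pi * Complex.I * (m i : ℂ))‖ = 1 := by
    simp [Complex.norm_exp]
  funext i
  rw [Logt, norm_mul, hnorm, one_mul, Logt]

lemma Logt_sreal {n : ℕ} {t : ℝ} (ht : 0 < t) (ht1 : t < 1) (x : Fin n → ℝ) :
    Logt t (sreal t x) = x := by
  have hlog : Real.log t ≠ 0 := (Real.log_neg ht ht1).ne
  funext i
  rw [Logt, sreal, Complex.norm_real, Real.norm_of_nonneg (Real.rpow_nonneg ht.le _),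
    Real.log_rpow ht, mul_div_cancel_right₀ _ hlog]

end Torus

/-! ### Estimates for the contraction -/

/-- Radial truncation to the closed disc of radius `M`. -/
def clamp (M : ℝ) (c : ℂ) : ℂ := ((min ‖c‖ M : ℝ) : ℂ) * phase c

lemma clamp_of_norm_le {M : ℝ} {c : ℂ} (h : ‖c‖ ≤ M) : clamp M c = c := by
  rw [clamp, min_eq_left h, norm_mul_phase]

lemma norm_clamp_le {M : ℝ} (hM : 0 ≤ M) (c : ℂ) : ‖clamp M c‖ ≤ M := by
  have hmin : 0 ≤ min ‖c‖ M := le_min (norm_nonneg c) hM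
  rw [clamp, norm_mul, Complex.norm_real, Real.norm_of_nonneg hmin]
  exact (mul_le_of_le_one_right hmin (norm_phase_le_one c)).trans (min_le_right _ _)

lemma continuousAt_clamp (M : ℝ) {c : ℂ} (hc : c ≠ 0) : ContinuousAt (clamp M) c :=
  ContinuousAt.mul (by fun_prop) (continuousAt_phase hc)

lemma clamp_mul_exp {M : ℝ} (hM : 0 < M) {c : ℂ} (hc : c ≠ 0) (ζ : ℂ) :
    clamp M (c * Complex.exp ζ) =
      phase c * Complex.exp ⟨min (Real.log ‖c‖ + ζ.re) (Real.log M), ζ.im⟩ := by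
  have hnorm : ‖c * Complex.exp ζ‖ = Real.exp (Real.log ‖c‖ + ζ.re) := by
    rw [norm_mul, Complex.norm_exp, Real.exp_add, Real.exp_log (norm_pos_iff.2 hc)]
  have hphase : phase (Complex.exp ζ) = Complex.exp (ζ.im * Complex.I) := by
    conv_lhs => rw [← Complex.re_add_im ζ, Complex.exp_add, phase_mul, ← Complex.ofReal_exp,
      phase_ofReal_of_pos (Real.exp_pos _), one_mul,
      phase_of_norm_eq_one (Complex.norm_exp_ofReal_mul_I _)]
  have hmin : min ‖c * Complex.exp ζ‖ M =
      Real.exp (min (Real.log ‖c‖ + ζ.re) (Real.log M)) := by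
    rw [Real.exp_monotone.map_min, Real.exp_log hM, hnorm]
  rw [clamp, hmin, phase_mul, hphase, Complex.mk_eq_add_mul_I, Complex.exp_add, Complex.ofReal_exp]
  ring

lemma norm_exp_sub_exp_le {M : ℝ} {a b : ℂ} (ha : a.re ≤ M) (hb : b.re ≤ M) :
    ‖Complex.exp a - Complex.exp b‖ ≤ Real.exp M * ‖a - b‖ := by
  refine (convex_halfSpace_re_le M).norm_image_sub_le_of_norm_deriv_le
    (fun _ _ => Complex.differentiableAt_exp) (fun x hx => ?_) hb ha
  rw [Complex.deriv_exp, Complex.norm_exp]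
  exact Real.exp_le_exp.2 hx

lemma norm_clamp_mul_exp_sub_le {M : ℝ} (hM : 0 < M) {c : ℂ} (hc : c ≠ 0) (ζ ζ' : ℂ) :
    ‖clamp M (c * Complex.exp ζ) - clamp M (c * Complex.exp ζ')‖ ≤
      M * (|ζ.re - ζ'.re| + |ζ.im - ζ'.im|) := by
  rw [clamp_mul_exp hM hc, clamp_mul_exp hM hc, ← mul_sub, norm_mul, norm_phase hc, one_mul]
  refine (norm_exp_sub_exp_le (M := Real.log M) (min_le_right _ _) (min_le_right _ _)).trans ?_
  rw [Real.exp_log hM]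
  gcongr
  refine (Complex.norm_le_abs_re_add_abs_im _).trans (add_le_add ?_ le_rfl)
  simpa using abs_min_sub_min_le_max (Real.log ‖c‖ + ζ.re) (Real.log M)
    (Real.log ‖c‖ + ζ'.re) (Real.log M)

lemma one_add_mem_slitPlane {x : ℂ} (hx : ‖x‖ ≤ 1 / 2) : 1 + x ∈ Complex.slitPlane :=
  Complex.mem_slitPlane_of_norm_lt_one (hx.trans_lt (by norm_num))

lemma norm_log_one_add_sub_le {a b : ℂ} (ha : ‖a‖ ≤ 1 / 2) (hb : ‖b‖ ≤ 1 / 2) :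
    ‖Complex.log (1 + a) - Complex.log (1 + b)‖ ≤ 2 * ‖a - b‖ := by
  refine (convex_closedBall (0 : ℂ) (1 / 2)).norm_image_sub_le_of_norm_hasDerivWithin_le
    (f := fun x => Complex.log (1 + x)) (f' := fun x => 1 / (1 + x)) (fun x hx => ?_)
    (fun x hx => ?_) (mem_closedBall_zero_iff.2 hb) (mem_closedBall_zero_iff.2 ha)
  · exact (((hasDerivAt_id x).const_add 1).clog
      (one_add_mem_slitPlane (mem_closedBall_zero_iff.1 hx))).hasDerivWithinAt
  · have hlower : 1 - ‖x‖ ≤ ‖1 + x‖ := by simpa using norm_sub_norm_le (1 : ℂ) (-x)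
    have hhalf : 1 / 2 ≤ ‖1 + x‖ := by linarith [mem_closedBall_zero_iff.1 hx]
    rw [norm_div, norm_one, div_le_iff₀ (by linarith)]
    linarith

lemma exp_log_one_add {a : ℂ} (ha : ‖a‖ ≤ 1 / 2) : Complex.exp (Complex.log (1 + a)) = 1 + a :=
  Complex.exp_log (Complex.slitPlane_ne_zero (one_add_mem_slitPlane ha))

lemma eq_log_one_add_of_exp_eq {w a : ℂ} (ha : ‖a‖ ≤ 1 / 2) (hw : Complex.exp w = 1 + a)
    (him : |w.im| ≤ Real.pi) : w = Complex.log (1 + a) := by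
  obtain ⟨hlo, hhi⟩ := abs_le.1 him
  have hne : -Real.pi ≠ w.im := fun h => by
    have hre : (Complex.exp w).re < 0 := by
      rw [Complex.exp_re, ← h, Real.cos_neg, Real.cos_pi]
      linarith [Real.exp_pos w.re]
    rw [hw, Complex.add_re, Complex.one_re] at hre
    linarith [neg_abs_le a.re, Complex.abs_re_le_norm a]
  rw [← hw, Complex.log_exp (lt_of_le_of_ne hlo hne) hhi]

lemma continuousAt_of_forall_contractingWith {X E : Type*} [TopologicalSpace X] [MetricSpace E]
    {K : NNReal} {T : X → E → E} {fix : X → E} {x : X}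
    (hT : ∀ᶠ y in nhds x, ContractingWith K (T y))
    (hfix : ∀ᶠ y in nhds x, Function.IsFixedPt (T y) (fix y))
    (hcont : ContinuousAt (fun y => T y (fix x)) x) : ContinuousAt fix x := by
  have hx : T x (fix x) = fix x := hfix.self_of_nhds
  have hzero :
      Filter.Tendsto (fun y => dist (fix x) (T y (fix x)) / (1 - K)) (nhds x) (nhds 0) := by
    have := (tendsto_const_nhds (x := fix x)).dist hcont.tendsto
    simpa [hx] using this.div_const (1 - K : ℝ)
  refine tendsto_iff_dist_tendsto_zero.2
    (squeeze_zero' (Filter.Eventually.of_forall fun _ => dist_nonneg) ?_ hzero)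
  filter_upwards [hT, hfix] with y hTy hy
  rw [dist_comm]
  exact hTy.dist_le_of_fixedPoint _ hy

/-! ### The zeros of `W` on the orbits -/

variable {n p : ℕ} {P : Potential n p} {j : Fin p}

variable {n p : ℕ} {P : Potential n p} {j : Fin p}

namespace Potential

lemma term_ne_zero (P : Potential n p) {t : ℝ} (ht : 0 < t) (k : Fin p) {z : Fin n → ℂ}
    (hz : ∀ i, z i ≠ 0) : P.term t k z ≠ 0 :=
  mul_ne_zero (Complex.ofReal_ne_zero.2 (Real.rpow_pos_of_pos ht _).ne') (monom_ne_zero _ hz)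

lemma continuousAt_term (P : Potential n p) (t : ℝ) (k : Fin p) {z : Fin n → ℂ}
    (hz : ∀ i, z i ≠ 0) : ContinuousAt (P.term t k) z :=
  continuousAt_const.mul (continuousAt_monom _ hz)

lemma continuousAt_W (P : Potential n p) (t : ℝ) {z : Fin n → ℂ} (hz : ∀ i, z i ≠ 0) :
    ContinuousAt (P.W t) z :=
  continuousAt_const.add (tendsto_finsetSum _ fun k _ => P.continuousAt_term t k hz)

lemma chi_add_smul_ivec (P : Potential n p) (k : Fin p) (x : Fin n → ℝ) (s : ℝ)
    (m : Fin n → ℤ) : P.chi k (x + s • ivec m) = P.chi k x + s * ((P.v k ⬝ᵥ m : ℤ) : ℝ) := by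
  rw [chi, chi, pair_add, pair_smul, pair_ivec, add_assoc]

lemma term_polar (P : Potential n p) {t : ℝ} (ht : 0 < t) (k : Fin p) (x θ : Fin n → ℝ) :
    P.term t k (polar t x θ) =
      (t ^ P.chi k x : ℝ) * Complex.exp (Complex.I * (pair (P.v k) θ : ℝ)) := by
  rw [term, monom_polar ht, ← mul_assoc, ← Complex.ofReal_mul, ← Real.rpow_add ht, chi]

lemma norm_term (P : Potential n p) {t : ℝ} (ht : 0 < t) (ht1 : t < 1) (k : Fin p)
    {z : Fin n → ℂ} (hz : ∀ i, z i ≠ 0) : ‖P.term t k z‖ = t ^ P.chi k (Logt t z) := by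
  rw [← polar_Logt ht ht1 hz, P.term_polar ht, norm_mul, Complex.norm_exp_I_mul_ofReal, mul_one,
    Complex.norm_real, Real.norm_of_nonneg (Real.rpow_nonneg ht.le _), Logt_polar ht ht1]

lemma chi_Logt_eq_zero_iff (P : Potential n p) {t : ℝ} (ht : 0 < t) (ht1 : t < 1) (k : Fin p)
    {z : Fin n → ℂ} (hz : ∀ i, z i ≠ 0) : P.chi k (Logt t z) = 0 ↔ ‖P.term t k z‖ = 1 := by
  rw [P.norm_term ht ht1 k hz, Real.rpow_def_of_pos ht, Real.exp_eq_one_iff, mul_eq_zero,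
    or_iff_right (Real.log_neg ht ht1).ne]

lemma term_act (P : Potential n p) (v γ : Fin n → ℤ) {t : ℝ} (ht : 0 < t) (ht1 : t < 1)
    (k : Fin p) (r : ℝ) {c : ℂ} (hc : ‖c‖ = 1) {z : Fin n → ℂ} (hz : ∀ i, z i ≠ 0) :
    P.term t k (act v γ r c z) = P.term t k z *
      ((Real.exp (r * ((P.v k ⬝ᵥ v : ℤ) / normSq v)) : ℝ) * c ^ (P.v k ⬝ᵥ γ)) := by
  have hlog : Real.log t ≠ 0 := (Real.log_neg ht ht1).ne
  obtain ⟨α, -, rfl⟩ := exists_exp_I_mul_eq hc 0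
  have hexp : Real.log t * (r / Real.log t / normSq v * ((P.v k ⬝ᵥ v : ℤ) : ℝ)) =
      r * ((P.v k ⬝ᵥ v : ℤ) / normSq v) := by field_simp
  rw [← polar_Logt ht ht1 hz, act_polar v γ ht ht1, P.term_polar ht, P.term_polar ht,
    chi_add_smul_ivec, Real.rpow_add ht, Real.rpow_def_of_pos ht (_ * _), hexp, pair_add, pair_smul,
    pair_ivec, ← Complex.exp_int_mul, Complex.ofReal_add, mul_add, Complex.exp_add]
  push_cast
  ring_nf

lemma term_act_self (P : Potential n p) {γ : Fin n → ℤ} (hγ : P.v j ⬝ᵥ γ = 1) {t : ℝ}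
    (ht : 0 < t) (ht1 : t < 1) (r : ℝ) {c : ℂ} (hc : ‖c‖ = 1) {z : Fin n → ℂ}
    (hz : ∀ i, z i ≠ 0) :
    P.term t j (act (P.v j) γ r c z) = P.term t j z * (Real.exp r * c) := by
  have hdiv : ((P.v j ⬝ᵥ P.v j : ℤ) : ℝ) / normSq (P.v j) = 1 :=
    div_self (normSq_pos_of_dotProduct_eq_one hγ).ne'
  rw [P.term_act _ _ ht ht1 _ _ hc hz, hγ, hdiv, mul_one, zpow_one]

lemma term_actC (P : Potential n p) (v γ : Fin n → ℤ) {t : ℝ} (ht : 0 < t) (ht1 : t < 1)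
    (k : Fin p) (w : ℂ) {z : Fin n → ℂ} (hz : ∀ i, z i ≠ 0) :
    P.term t k (actC v γ w z) = P.term t k z * Complex.exp
      ⟨w.re * ((P.v k ⬝ᵥ v : ℤ) / normSq v), w.im * (P.v k ⬝ᵥ γ : ℤ)⟩ := by
  rw [actC, P.term_act _ _ ht ht1 _ _ (Complex.norm_exp_I_mul_ofReal _) hz,
    Complex.mk_eq_add_mul_I, Complex.exp_add, Complex.ofReal_exp, ← Complex.exp_int_mul]
  congr 3
  push_cast
  ring

lemma term_actC_self (P : Potential n p) {γ : Fin n → ℤ} (hγ : P.v j ⬝ᵥ γ = 1) {t : ℝ}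
    (ht : 0 < t) (ht1 : t < 1) (w : ℂ) {z : Fin n → ℂ} (hz : ∀ i, z i ≠ 0) :
    P.term t j (actC (P.v j) γ w z) = P.term t j z * Complex.exp w := by
  rw [actC, P.term_act_self hγ ht ht1 _ (Complex.norm_exp_I_mul_ofReal _) hz, Complex.ofReal_exp,
    ← Complex.exp_add, mul_comm Complex.I, Complex.re_add_im]

lemma term_slide (P : Potential n p) {t : ℝ} (ht : 0 < t) (ht1 : t < 1) {a : Fin n → ℝ}
    (ha : P.chi j a = 0) (s : ℝ) {z : Fin n → ℂ} (hz : ∀ i, z i ≠ 0)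
    (hchi : P.chi j (Logt t z) = 0) : P.term t j (slide t a s z) = P.term t j z := by
  have hslide : P.chi j ((1 - s) • Logt t z + s • a) = 0 := by
    simp only [chi, pair_add, pair_smul] at ha hchi ⊢
    linear_combination (1 - s) * hchi + s * ha
  have hterm := P.term_polar ht j (Logt t z) fun i => (z i).arg
  rw [polar_Logt ht ht1 hz] at hterm
  rw [hterm, ← polar_Logt ht ht1 hz, slide_polar a ht ht1, P.term_polar ht, polar_Logt ht ht1 hz,
    hslide, hchi]

end Potential

namespace FacetNbhd

variable (N : FacetNbhd P j)

/-- The sum of the terms `k ≠ j` of the potential, each truncated at modulus `t ^ c_k`. The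
truncation does nothing over `U`, but makes the contraction below defined on all of `ℂ`. -/
def rest (t : ℝ) (z : Fin n → ℂ) : ℂ :=
  ∑ k ∈ Finset.univ.erase j, clamp (t ^ N.c k) (P.term t k z)

/-- An upper bound for `rest`. -/
def restBound (t : ℝ) : ℝ := ∑ k ∈ Finset.univ.erase j, t ^ N.c k

/-- A Lipschitz constant of `rest` along the orbits of `actC`. -/
def restLip (γ : Fin n → ℤ) (t : ℝ) : ℝ :=
  ∑ k ∈ Finset.univ.erase j, t ^ N.c k *
    (|((P.v k ⬝ᵥ P.v j : ℤ) : ℝ) / normSq (P.v j)| + |((P.v k ⬝ᵥ γ : ℤ) : ℝ)|)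

variable {γ : Fin n → ℤ} {t : ℝ}

lemma rest_eq_sum (ht : 0 < t) (ht1 : t < 1) {z : Fin n → ℂ} (hz : ∀ i, z i ≠ 0)
    (hU : Logt t z ∈ N.U) : N.rest t z = ∑ k ∈ Finset.univ.erase j, P.term t k z := by
  refine Finset.sum_congr rfl fun k hk => clamp_of_norm_le ?_
  rw [P.norm_term ht ht1 k hz]
  exact Real.rpow_le_rpow_of_exponent_ge ht ht1.le
    (N.lt_chi _ hU k (Finset.ne_of_mem_erase hk)).le

lemma W_eq_add_rest (ht : 0 < t) (ht1 : t < 1) {z : Fin n → ℂ} (hz : ∀ i, z i ≠ 0)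
    (hU : Logt t z ∈ N.U) : P.W t z = 1 + P.term t j z + N.rest t z := by
  rw [N.rest_eq_sum ht ht1 hz hU, Potential.W, ← Finset.add_sum_erase _ _ (Finset.mem_univ j),
    add_assoc]

lemma norm_rest_le (ht : 0 < t) (z : Fin n → ℂ) : ‖N.rest t z‖ ≤ N.restBound t :=
  norm_sum_le_of_le _ fun _ _ => norm_clamp_le (Real.rpow_nonneg ht.le _) _

lemma continuousAt_rest (ht : 0 < t) {z : Fin n → ℂ} (hz : ∀ i, z i ≠ 0) :
    ContinuousAt (N.rest t) z :=
  tendsto_finsetSum _ fun k _ => ContinuousAt.comp (g := clamp (t ^ N.c k))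
    (continuousAt_clamp _ (P.term_ne_zero ht k hz)) (P.continuousAt_term t k hz)

lemma norm_rest_actC_sub_le (ht : 0 < t) (ht1 : t < 1) {z : Fin n → ℂ} (hz : ∀ i, z i ≠ 0)
    (w w' : ℂ) : ‖N.rest t (actC (P.v j) γ w z) - N.rest t (actC (P.v j) γ w' z)‖ ≤
      N.restLip γ t * ‖w - w'‖ := by
  rw [rest, rest, ← Finset.sum_sub_distrib, restLip, Finset.sum_mul]
  refine norm_sum_le_of_le _ fun k _ => ?_
  rw [P.term_actC _ _ ht ht1 k w hz, P.term_actC _ _ ht ht1 k w' hz, mul_assoc]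
  refine (norm_clamp_mul_exp_sub_le (Real.rpow_pos_of_pos ht _) (P.term_ne_zero ht k hz) _ _).trans
    (mul_le_mul_of_nonneg_left ?_ (Real.rpow_nonneg ht.le _))
  have hre := Complex.sub_re w w' ▸ Complex.abs_re_le_norm (w - w')
  have him := Complex.sub_im w w' ▸ Complex.abs_im_le_norm (w - w')
  rw [← sub_mul, ← sub_mul, abs_mul, abs_mul, add_mul, mul_comm |w.re - w'.re|,
    mul_comm |w.im - w'.im|]
  gcongr

/-- The map `w ↦ log (1 + rest (w · z))`. For `z` with `t ^ λ_j z ^ v_j = -1`, its fixed points are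
the zeros of `W` on the orbit of `z` under `actC`. -/
def rootMap (γ : Fin n → ℤ) (t : ℝ) (z : Fin n → ℂ) (w : ℂ) : ℂ :=
  Complex.log (1 + N.rest t (actC (P.v j) γ w z))

/-- The fixed point of `rootMap`, which is unique for small `t`. -/
def root (γ : Fin n → ℤ) (t : ℝ) (z : Fin n → ℂ) : ℂ :=
  Classical.epsilon fun w => Function.IsFixedPt (N.rootMap γ t z) w

/-- The smallness of `t` needed to find the zeros of `W` on the orbits of `actC` by contraction. -/
structure IsContracting (γ : Fin n → ℤ) (t : ℝ) : Prop where
  pos : 0 < t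
  lt_one : t < 1
  restBound_le : N.restBound t ≤ 1 / 10
  restLip_le : N.restLip γ t ≤ 1 / 4

namespace IsContracting

variable {N} (ht : N.IsContracting γ t) {z : Fin n → ℂ} (hz : ∀ i, z i ≠ 0)
include ht

lemma norm_rest_le_half (z : Fin n → ℂ) : ‖N.rest t z‖ ≤ 1 / 2 :=
  (N.norm_rest_le ht.pos z).trans (ht.restBound_le.trans (by norm_num))

include hz

lemma contractingWith_rootMap : ContractingWith (1 / 2) (N.rootMap γ t z) := by
  refine ⟨by norm_num, LipschitzWith.of_dist_le_mul fun w w' => ?_⟩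
  have hrest := (N.norm_rest_actC_sub_le ht.pos ht.lt_one hz w w').trans
    (mul_le_mul_of_nonneg_right ht.restLip_le (norm_nonneg _))
  have hlog := norm_log_one_add_sub_le (ht.norm_rest_le_half (actC (P.v j) γ w z))
    (ht.norm_rest_le_half (actC (P.v j) γ w' z))
  rw [dist_eq_norm, dist_eq_norm]
  push_cast
  unfold rootMap
  linarith

lemma isFixedPt_root : Function.IsFixedPt (N.rootMap γ t z) (N.root γ t z) :=
  Classical.epsilon_spec
    ⟨_, (ht.contractingWith_rootMap hz).fixedPoint_isFixedPt⟩

lemma exp_root : Complex.exp (N.root γ t z) =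
    1 + N.rest t (actC (P.v j) γ (N.root γ t z) z) := by
  conv_lhs => rw [← ht.isFixedPt_root hz]
  exact exp_log_one_add (ht.norm_rest_le_half _)

lemma eq_root_of_exp_eq {w : ℂ} (hlo : -Real.pi < w.im) (hhi : w.im ≤ Real.pi)
    (hw : Complex.exp w = 1 + N.rest t (actC (P.v j) γ w z)) : w = N.root γ t z :=
  (ht.contractingWith_rootMap hz).fixedPoint_unique'
    (by rw [Function.IsFixedPt, rootMap, ← hw, Complex.log_exp hlo hhi]) (ht.isFixedPt_root hz)

lemma norm_root_le : ‖N.root γ t z‖ ≤ 2 * N.restBound t := by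
  have hle := N.norm_rest_le ht.pos (actC (P.v j) γ (N.root γ t z) z)
  rw [← ht.isFixedPt_root hz]
  refine (Complex.norm_log_one_add_half_le_self (ht.norm_rest_le_half _)).trans ?_
  linarith [norm_nonneg (N.rest t (actC (P.v j) γ (N.root γ t z) z))]

lemma continuousAt_root : ContinuousAt (N.root γ t) z := by
  have hev : ∀ᶠ z' in nhds z, ∀ i, z' i ≠ 0 :=
    Filter.eventually_all.2 fun i => (continuous_apply i).continuousAt.eventually_ne (hz i)
  refine continuousAt_of_forall_contractingWith
    (hev.mono fun _ => ht.contractingWith_rootMap) (hev.mono fun _ => ht.isFixedPt_root) ?_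
  have hact : ContinuousAt (fun z' => actC (P.v j) γ (N.root γ t z) z') z :=
    continuousAt_act _ _ continuousAt_const continuousAt_const (Complex.exp_ne_zero _)
      continuousAt_id
  have hrest : ContinuousAt (fun z' => N.rest t (actC (P.v j) γ (N.root γ t z) z')) z :=
    ContinuousAt.comp (g := N.rest t) (N.continuousAt_rest ht.pos (actC_ne_zero _ _ _ hz)) hact
  exact (continuousAt_const.add hrest).clog (one_add_mem_slitPlane (ht.norm_rest_le_half _))

end IsContracting

end FacetNbhd

namespace Potential

/-- The point of the orbit of `z` under `act` at which the `j`-th term of `W` is `-1`. -/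
def flat (P : Potential n p) (j : Fin p) (γ : Fin n → ℤ) (t : ℝ) (z : Fin n → ℂ) : Fin n → ℂ :=
  act (P.v j) γ (-Real.log ‖P.term t j z‖) (phase (-P.term t j z))⁻¹ z

variable {γ : Fin n → ℤ} {t : ℝ} {z : Fin n → ℂ}

lemma norm_phase_neg_term (ht : 0 < t) (hz : ∀ i, z i ≠ 0) : ‖phase (-P.term t j z)‖ = 1 :=
  norm_phase (neg_ne_zero.2 (P.term_ne_zero ht j hz))

lemma phase_neg_term_ne_zero (ht : 0 < t) (hz : ∀ i, z i ≠ 0) : phase (-P.term t j z) ≠ 0 :=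
  phase_ne_zero (neg_ne_zero.2 (P.term_ne_zero ht j hz))

lemma continuousAt_phase_neg_term (ht : 0 < t) (hz : ∀ i, z i ≠ 0) :
    ContinuousAt (fun z => phase (-P.term t j z)) z :=
  ContinuousAt.comp (g := phase) (continuousAt_phase (neg_ne_zero.2 (P.term_ne_zero ht j hz)))
    (P.continuousAt_term t j hz).neg

lemma continuousAt_log_norm_term (ht : 0 < t) (hz : ∀ i, z i ≠ 0) :
    ContinuousAt (fun z => Real.log ‖P.term t j z‖) z :=
  (P.continuousAt_term t j hz).norm.log (norm_ne_zero_iff.2 (P.term_ne_zero ht j hz))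

lemma flat_ne_zero (ht : 0 < t) (hz : ∀ i, z i ≠ 0) (i : Fin n) : P.flat j γ t z i ≠ 0 :=
  act_ne_zero _ _ _ (inv_ne_zero (phase_neg_term_ne_zero ht hz)) hz i

lemma term_flat (hγ : P.v j ⬝ᵥ γ = 1) (ht : 0 < t) (ht1 : t < 1) (hz : ∀ i, z i ≠ 0) :
    P.term t j (P.flat j γ t z) = -1 := by
  have hT := P.term_ne_zero ht j hz
  have hphase := phase_neg_term_ne_zero (P := P) (j := j) ht hz
  have hnorm : (‖P.term t j z‖ : ℂ) ≠ 0 := Complex.ofReal_ne_zero.2 (norm_ne_zero_iff.2 hT)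
  have hpolar : P.term t j z = -(‖P.term t j z‖ * phase (-P.term t j z)) := by
    rw [← norm_neg, norm_mul_phase, neg_neg]
  rw [flat, P.term_act_self hγ ht ht1 _ (by rw [norm_inv, norm_phase_neg_term ht hz, inv_one]) hz,
    Real.exp_neg, Real.exp_log (norm_pos_iff.2 hT), Complex.ofReal_inv]
  nth_rewrite 1 [hpolar]
  field_simp

lemma act_flat (ht : 0 < t) (hz : ∀ i, z i ≠ 0) :
    act (P.v j) γ (Real.log ‖P.term t j z‖) (phase (-P.term t j z)) (P.flat j γ t z) = z := by
  rw [flat, act_act, add_neg_cancel, mul_inv_cancel₀ (phase_neg_term_ne_zero ht hz), act_zero_one]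

lemma actC_log_neg_term_flat (ht : 0 < t) (hz : ∀ i, z i ≠ 0) :
    actC (P.v j) γ (Complex.log (-P.term t j z)) (P.flat j γ t z) = z := by
  rw [actC, Complex.log_re, norm_neg, Complex.log_im,
    exp_I_mul_arg (neg_ne_zero.2 (P.term_ne_zero ht j hz)), act_flat ht hz]

lemma Logt_flat (ht : 0 < t) (ht1 : t < 1) (hz : ∀ i, z i ≠ 0) :
    Logt t (P.flat j γ t z) = Logt t z +
      (-Real.log ‖P.term t j z‖ / Real.log t / normSq (P.v j)) • ivec (P.v j) :=
  Logt_act _ _ ht ht1 _ (by rw [norm_inv, norm_phase_neg_term ht hz, inv_one]) hz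

lemma continuousAt_flat (ht : 0 < t) (hz : ∀ i, z i ≠ 0) : ContinuousAt (P.flat j γ t) z :=
  have hphase := phase_neg_term_ne_zero (P := P) (j := j) ht hz
  continuousAt_act _ _ (continuousAt_log_norm_term ht hz).neg
    ((continuousAt_phase_neg_term ht hz).inv₀ hphase) (inv_ne_zero hphase) continuousAt_id

end Potential

namespace FacetNbhd

variable (N : FacetNbhd P j) (γ : Fin n → ℤ) (t : ℝ)

/-- For `y` with `t ^ λ_j y ^ v_j = -1` and small `t`, the zero of `W` on the orbit of `y`. -/
def zeroOf (y : Fin n → ℂ) : Fin n → ℂ := actC (P.v j) γ (N.root γ t y) y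

/-- The radial coordinate of `z` on its orbit, measured from the zero of `W`. -/
def relLog (z : Fin n → ℂ) : ℝ := Real.log ‖P.term t j z‖ - (N.root γ t (P.flat j γ t z)).re

/-- The angular coordinate of `z` on its orbit, measured from the zero of `W`. -/
def relPhase (z : Fin n → ℂ) : ℂ :=
  phase (-P.term t j z) * Complex.exp (Complex.I * ((-(N.root γ t (P.flat j γ t z)).im : ℝ) : ℂ))

/-- The orbit of `z` is moved, together with its zero of `W`, to the orbit over `a`; meanwhile the
radial coordinate is contracted and the angular coordinate twisted. -/
def baseMove (a : Fin n → ℝ) (s : ℝ) (z : Fin n → ℂ) : Fin n → ℂ :=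
  act (P.v j) γ ((1 - s) * N.relLog γ t z) (twist (2 * s) (N.relPhase γ t z))
    (N.zeroOf γ t (slide t a s (P.flat j γ t z)))

variable {N γ t} {a : Fin n → ℝ} {z : Fin n → ℂ}

lemma zeroOf_ne_zero {y : Fin n → ℂ} (hy : ∀ i, y i ≠ 0) (i : Fin n) : N.zeroOf γ t y i ≠ 0 :=
  actC_ne_zero _ _ _ hy i

lemma Logt_zeroOf (ht : 0 < t) (ht1 : t < 1) {y : Fin n → ℂ} (hy : ∀ i, y i ≠ 0) :
    Logt t (N.zeroOf γ t y) = Logt t y +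
      ((N.root γ t y).re / Real.log t / normSq (P.v j)) • ivec (P.v j) :=
  Logt_act _ _ ht ht1 _ (Complex.norm_exp_I_mul_ofReal _) hy

lemma norm_relPhase (ht : 0 < t) (hz : ∀ i, z i ≠ 0) : ‖N.relPhase γ t z‖ = 1 := by
  rw [relPhase, norm_mul, Potential.norm_phase_neg_term ht hz, Complex.norm_exp_I_mul_ofReal,
    one_mul]

lemma twist_relPhase_ne_zero (ht : 0 < t) (s : ℝ) (hz : ∀ i, z i ≠ 0) :
    twist s (N.relPhase γ t z) ≠ 0 :=
  norm_ne_zero_iff.1 (by rw [norm_twist, norm_relPhase ht hz]; exact one_ne_zero)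

lemma baseMove_ne_zero (ht : 0 < t) (s : ℝ) (hz : ∀ i, z i ≠ 0) (i : Fin n) :
    N.baseMove γ t a s z i ≠ 0 :=
  act_ne_zero _ _ _ (twist_relPhase_ne_zero ht _ hz)
    (zeroOf_ne_zero (slide_ne_zero _ _ (Potential.flat_ne_zero ht hz))) i

lemma baseMove_zero (ht : 0 < t) (hz : ∀ i, z i ≠ 0) : N.baseMove γ t a 0 z = z := by
  have hphase : N.relPhase γ t z *
      Complex.exp (Complex.I * ((N.root γ t (P.flat j γ t z)).im : ℂ)) =
        phase (-P.term t j z) := by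
    rw [relPhase, mul_assoc, ← Complex.exp_add]
    simp
  rw [baseMove, slide_zero, mul_zero, twist_zero_left, zeroOf, actC, act_act, hphase, relLog,
    sub_zero, one_mul, sub_add_cancel, Potential.act_flat ht hz]

lemma Logt_baseMove (ht : 0 < t) (ht1 : t < 1) (s : ℝ) (hz : ∀ i, z i ≠ 0) :
    Logt t (N.baseMove γ t a s z) = ((1 - s) • Logt t z + s • a) +
      ((-(1 - s) * (N.root γ t (P.flat j γ t z)).re +
        (N.root γ t (slide t a s (P.flat j γ t z))).re) / Real.log t / normSq (P.v j)) •
          ivec (P.v j) := by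
  have hflat := Potential.flat_ne_zero (P := P) (j := j) (γ := γ) ht hz
  have hslide := slide_ne_zero (t := t) a s hflat
  rw [baseMove, Logt_act _ _ ht ht1 _ (by rw [norm_twist, norm_relPhase ht hz])
    (zeroOf_ne_zero hslide), Logt_zeroOf ht ht1 hslide, Logt_slide a ht ht1 s hflat,
    Potential.Logt_flat ht ht1 hz, relLog]
  module

namespace IsContracting

variable (ht : N.IsContracting γ t)
include ht

lemma W_zeroOf_eq_zero (hγ : P.v j ⬝ᵥ γ = 1) {y : Fin n → ℂ} (hy : ∀ i, y i ≠ 0)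
    (hT : P.term t j y = -1) (hU : Logt t (N.zeroOf γ t y) ∈ N.U) :
    P.W t (N.zeroOf γ t y) = 0 := by
  rw [N.W_eq_add_rest ht.pos ht.lt_one (zeroOf_ne_zero hy) hU, zeroOf,
    P.term_actC_self hγ ht.pos ht.lt_one _ hy, hT, ht.exp_root hy]
  ring

lemma log_neg_term_eq_root (hz : ∀ i, z i ≠ 0) (hU : Logt t z ∈ N.U) (hW : P.W t z = 0) :
    Complex.log (-P.term t j z) = N.root γ t (P.flat j γ t z) := by
  refine ht.eq_root_of_exp_eq (Potential.flat_ne_zero ht.pos hz) (Complex.neg_pi_lt_log_im _)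
    (Complex.log_im_le_pi _) ?_
  rw [N.W_eq_add_rest ht.pos ht.lt_one hz hU] at hW
  rw [Complex.exp_log (neg_ne_zero.2 (P.term_ne_zero ht.pos j hz)),
    Potential.actC_log_neg_term_flat ht.pos hz]
  linear_combination -hW

lemma relLog_eq_zero (hz : ∀ i, z i ≠ 0) (hU : Logt t z ∈ N.U) (hW : P.W t z = 0) :
    N.relLog γ t z = 0 := by
  rw [relLog, ← ht.log_neg_term_eq_root hz hU hW, Complex.log_re, norm_neg, sub_self]

lemma relPhase_eq_one (hz : ∀ i, z i ≠ 0) (hU : Logt t z ∈ N.U) (hW : P.W t z = 0) :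
    N.relPhase γ t z = 1 := by
  rw [relPhase, ← ht.log_neg_term_eq_root hz hU hW, Complex.log_im,
    ← exp_I_mul_arg (neg_ne_zero.2 (P.term_ne_zero ht.pos j hz)), ← Complex.exp_add]
  simp

lemma term_slide_flat (hγ : P.v j ⬝ᵥ γ = 1) (ha : P.chi j a = 0) (s : ℝ) (hz : ∀ i, z i ≠ 0) :
    P.term t j (slide t a s (P.flat j γ t z)) = -1 := by
  have hflat := Potential.term_flat hγ ht.pos ht.lt_one hz
  have hne := Potential.flat_ne_zero (P := P) (j := j) (γ := γ) ht.pos hz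
  rw [P.term_slide ht.pos ht.lt_one ha s hne, hflat]
  rw [P.chi_Logt_eq_zero_iff ht.pos ht.lt_one j hne, hflat, norm_neg, norm_one]

lemma W_baseMove_eq_zero (hγ : P.v j ⬝ᵥ γ = 1) (ha : P.chi j a = 0) (s : ℝ)
    (hz : ∀ i, z i ≠ 0) (hU : Logt t z ∈ N.U) (hU' : Logt t (N.baseMove γ t a s z) ∈ N.U)
    (hW : P.W t z = 0) : P.W t (N.baseMove γ t a s z) = 0 := by
  rw [baseMove, ht.relLog_eq_zero hz hU hW, ht.relPhase_eq_one hz hU hW, mul_zero, twist_one_right,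
    act_zero_one] at hU' ⊢
  exact ht.W_zeroOf_eq_zero hγ (slide_ne_zero _ _ (Potential.flat_ne_zero ht.pos hz))
    (ht.term_slide_flat hγ ha s hz) hU'

lemma continuousAt_zeroOf {y : Fin n → ℂ} (hy : ∀ i, y i ≠ 0) :
    ContinuousAt (N.zeroOf γ t) y := by
  have hroot := ht.continuousAt_root hy
  exact continuousAt_act _ _ (by fun_prop) (by fun_prop) (Complex.exp_ne_zero _) continuousAt_id

lemma continuousAt_root_flat (hz : ∀ i, z i ≠ 0) :
    ContinuousAt (fun z => N.root γ t (P.flat j γ t z)) z :=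
  ContinuousAt.comp (g := N.root γ t) (ht.continuousAt_root (Potential.flat_ne_zero ht.pos hz))
    (Potential.continuousAt_flat ht.pos hz)

lemma continuousAt_relLog (hz : ∀ i, z i ≠ 0) : ContinuousAt (N.relLog γ t) z :=
  (Potential.continuousAt_log_norm_term ht.pos hz).sub
    (Complex.continuous_re.continuousAt.comp (ht.continuousAt_root_flat hz))

lemma continuousAt_relPhase (hz : ∀ i, z i ≠ 0) : ContinuousAt (N.relPhase γ t) z := by
  have hroot := ht.continuousAt_root_flat hz
  exact (Potential.continuousAt_phase_neg_term ht.pos hz).mul (by fun_prop)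

lemma continuousAt_baseMove (s : ℝ) (hz : ∀ i, z i ≠ 0) :
    ContinuousAt (fun w : ℝ × (Fin n → ℂ) => N.baseMove γ t a w.1 w.2) (s, z) := by
  have hne := Potential.flat_ne_zero (P := P) (j := j) (γ := γ) ht.pos hz
  have hflat : ContinuousAt (fun w : ℝ × (Fin n → ℂ) => P.flat j γ t w.2) (s, z) :=
    ContinuousAt.comp (g := P.flat j γ t) (Potential.continuousAt_flat ht.pos hz) continuousAt_snd
  have hslide : ContinuousAt
      (fun w : ℝ × (Fin n → ℂ) => slide t a w.1 (P.flat j γ t w.2)) (s, z) :=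
    ContinuousAt.comp (g := fun w : ℝ × (Fin n → ℂ) => slide t a w.1 w.2)
      (f := fun w : ℝ × (Fin n → ℂ) => (w.1, P.flat j γ t w.2))
      (continuousAt_slide a s hne) (continuousAt_fst.prodMk hflat)
  have hzero : ContinuousAt
      (fun w : ℝ × (Fin n → ℂ) => N.zeroOf γ t (slide t a w.1 (P.flat j γ t w.2))) (s, z) :=
    ContinuousAt.comp (g := N.zeroOf γ t) (ht.continuousAt_zeroOf (slide_ne_zero a s hne)) hslide
  have hrelLog : ContinuousAt (fun w : ℝ × (Fin n → ℂ) => N.relLog γ t w.2) (s, z) :=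
    ContinuousAt.comp (g := N.relLog γ t) (ht.continuousAt_relLog hz) continuousAt_snd
  have hrelPhase : ContinuousAt (fun w : ℝ × (Fin n → ℂ) => N.relPhase γ t w.2) (s, z) :=
    ContinuousAt.comp (g := N.relPhase γ t) (ht.continuousAt_relPhase hz) continuousAt_snd
  have htwist : ContinuousAt
      (fun w : ℝ × (Fin n → ℂ) => twist (2 * w.1) (N.relPhase γ t w.2)) (s, z) :=
    ContinuousAt.comp (g := fun w : ℝ × ℂ => twist w.1 w.2)
      (f := fun w : ℝ × (Fin n → ℂ) => (2 * w.1, N.relPhase γ t w.2))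
      continuous_twist.continuousAt (ContinuousAt.prodMk (by fun_prop) hrelPhase)
  exact continuousAt_act _ _ (by fun_prop) htwist (twist_relPhase_ne_zero ht.pos _ hz) hzero

end IsContracting

end FacetNbhd

/-! ### The edge and the singular fiber -/

lemma TropPoly.mem_leading_of_cell_eq {n : ℕ} {f : TropPoly n} {x : Fin n → ℝ}
    {q q' : Fin n → ℤ} (h : f.cell x = segment ℝ (ivec q) (ivec q')) : q ∈ f.leading x := by
  obtain ⟨m, hm, hmq⟩ := extremePoints_convexHull_subset
    (h ▸ left_mem_extremePoints_segment (ivec q) (ivec q') : ivec q ∈ (f.cell x).extremePoints ℝ)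
  rwa [← ivec_injective hmq]

lemma TropPoly.coeff_add_pair_eq_of_cell_eq {n : ℕ} {f : TropPoly n} {x : Fin n → ℝ}
    {q q' : Fin n → ℤ} (h : f.cell x = segment ℝ (ivec q) (ivec q')) :
    f.coeff q + pair q x = f.coeff q' + pair q' x :=
  (mem_leading_of_cell_eq h).2.trans
    (mem_leading_of_cell_eq (h.trans (segment_symm ℝ _ _))).2.symm

namespace EdgeEnd

variable {N : FacetNbhd P j} {f : Fin (n - 1) → TropPoly n} (e : EdgeEnd N f)

lemma dotProduct_xi (k : Fin (n - 1)) : P.v j ⬝ᵥ e.xi k = 0 := by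
  have hstart := TropPoly.coeff_add_pair_eq_of_cell_eq ((e.edge 0 ⟨le_rfl, e.len_pos.le⟩).2 k)
  have hend := TropPoly.coeff_add_pair_eq_of_cell_eq ((e.edge e.len ⟨e.len_pos.le, le_rfl⟩).2 k)
  simp only [pair_add, pair_smul, pair_ivec, zero_mul, add_zero] at hstart hend
  have hmul : e.len * ((e.q k ⬝ᵥ P.v j : ℤ) : ℝ) = e.len * ((e.q' k ⬝ᵥ P.v j : ℤ) : ℝ) := by
    linarith
  have hdot : e.q k ⬝ᵥ P.v j = e.q' k ⬝ᵥ P.v j := by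
    exact_mod_cast mul_left_cancel₀ e.len_pos.ne' hmul
  rw [xi, dotProduct_comm, sub_dotProduct, hdot, sub_self]

/-- The vector of angles with coordinates `α` along `γ` and `η_k` along `ξ_k`. -/
def angles (γ : Fin n → ℤ) (α : ℝ) (η : Fin (n - 1) → ℝ) : Fin n → ℝ :=
  α • ivec γ + ∑ k, η k • ivec (e.xi k)

variable {γ : Fin n → ℤ}

lemma pair_angles (hγ : P.v j ⬝ᵥ γ = 1) (α : ℝ) (η : Fin (n - 1) → ℝ) :
    pair (P.v j) (e.angles γ α η) = α := by
  have hxi : ∀ k, ivec (P.v j) ⬝ᵥ ivec (e.xi k) = 0 := fun k => by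
    rw [← Int.cast_zero (R := ℝ), ← e.dotProduct_xi k]
    exact pair_ivec _ _
  rw [angles, pair_add, pair_smul, pair_ivec, hγ, Int.cast_one, mul_one, add_eq_left]
  refine (dotProduct_sum _ _ _).trans (Finset.sum_eq_zero fun k _ => ?_)
  rw [dotProduct_smul]
  exact smul_eq_zero_of_right _ (hxi k)

lemma exists_angles (hγ : P.v j ⬝ᵥ γ = 1) (θ : Fin n → ℝ) :
    ∃ α η, θ = e.angles γ α η := by
  have hxi : ∀ k, pair (P.v j) (ivec (e.q' k - e.q k)) = 0 := fun k => by
    rw [pair_ivec]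
    exact_mod_cast e.dotProduct_xi k
  obtain ⟨η, hη⟩ := exists_eq_smul_add_sum_smul
    (IsLinearMap.mk' (pair (P.v j)) ⟨pair_add _, pair_smul _⟩)
    (show pair (P.v j) (ivec γ) = 1 by rw [pair_ivec, hγ, Int.cast_one]) e.indep hxi
    (by rw [Module.finrank_fin_fun, Fintype.card_fin]; omega) θ
  exact ⟨_, η, hη⟩

section zpt

variable (t : ℝ) (γ : Fin n → ℤ) (x : Fin n → ℝ)

lemma zpt_eq_polar (τ α : ℝ) (η : Fin (n - 1) → ℝ) :
    e.zpt t γ x τ α η = polar t (x + τ • ivec (P.v j)) (e.angles γ α η) := by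
  funext i
  simp [zpt, polar, angles, ivec]

lemma zpt_ne_zero (τ α : ℝ) (η : Fin (n - 1) → ℝ) (i : Fin n) : e.zpt t γ x τ α η i ≠ 0 :=
  Complex.exp_ne_zero _

lemma zpt_congr (τ : ℝ) {α α' : ℝ} {η η' : Fin (n - 1) → ℝ}
    (hα : Complex.exp (Complex.I * (α : ℂ)) = Complex.exp (Complex.I * (α' : ℂ)))
    (hη : ∀ k, Complex.exp (Complex.I * (η k : ℂ)) = Complex.exp (Complex.I * (η' k : ℂ))) :
    e.zpt t γ x τ α η = e.zpt t γ x τ α' η' := by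
  obtain ⟨m, rfl⟩ := exp_I_mul_eq_exp_I_mul_iff.1 hα
  choose l hl using fun k => exp_I_mul_eq_exp_I_mul_iff.1 (hη k)
  obtain rfl := funext hl
  rw [zpt_eq_polar, zpt_eq_polar, ← polar_add_two_pi _ (e.angles γ α' η')
    (m • γ + ∑ k, l k • e.xi k)]
  congr 1
  funext i
  simp only [angles, mul_assoc, Pi.add_apply, Pi.smul_apply, ivec, smul_eq_mul, add_mul,
    Finset.sum_apply, Finset.sum_add_distrib, zsmul_eq_mul, Pi.mul_apply, Pi.intCast_apply,
    Int.cast_eq, Int.cast_add, Int.cast_mul, Int.cast_sum, mul_add, Finset.mul_sum]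
  ring

variable {t} (ht : 0 < t)
include ht

lemma exists_zpt_mem_cyc (h : ℝ) {η : Fin (n - 1) → ℝ}
    (hη : ∀ k, η k ∈ Set.Icc 0 (2 * Real.pi)) :
    ∃ m ∈ e.sigma, e.zpt t γ x 0 (2 * Real.pi * h) η ∈ cyc {m + h • ivec γ} (sreal t x) := by
  refine ⟨_, ⟨fun k => η k / (2 * Real.pi), fun k => ⟨div_nonneg (hη k).1 Real.two_pi_pos.le,
    (div_le_one Real.two_pi_pos).2 (hη k).2⟩, rfl⟩, ?_⟩
  rw [zpt_eq_polar, zero_smul, add_zero, ← polar_add_two_pi _ _ (∑ k, e.q k)]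
  convert polar_mem_cyc ht x _ using 2
  have hpi := Real.pi_pos.ne'
  funext i
  simp only [angles, ivec, Pi.add_apply, Pi.smul_apply, smul_eq_mul, Finset.sum_apply,
    Finset.sum_add_distrib, mul_add, Finset.mul_sum, Int.cast_sum]
  have hk : ∀ k, 2 * Real.pi * (η k / (2 * Real.pi) * (e.xi k i : ℝ)) = η k * e.xi k i :=
    fun k => by field_simp
  simp only [hk]
  ring

variable {γ} in
lemma term_zpt (hγ : P.v j ⬝ᵥ γ = 1) (α : ℝ) (η : Fin (n - 1) → ℝ) :
    P.term t j (e.zpt t γ x 0 α η) =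
      (t ^ P.chi j x : ℝ) * Complex.exp (Complex.I * (α : ℂ)) := by
  rw [zpt_eq_polar, zero_smul, add_zero, P.term_polar ht, e.pair_angles hγ]

variable {γ} in
lemma phase_neg_term_zpt (hγ : P.v j ⬝ᵥ γ = 1) (α : ℝ) (η : Fin (n - 1) → ℝ) :
    phase (-P.term t j (e.zpt t γ x 0 α η)) =
      Complex.exp (Complex.I * ((α - Real.pi : ℝ) : ℂ)) := by
  rw [e.term_zpt x ht hγ, ← mul_neg, phase_mul,
    phase_ofReal_of_pos (Real.rpow_pos_of_pos ht (P.chi j x)), one_mul,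
    phase_of_norm_eq_one (by rw [norm_neg, Complex.norm_exp_I_mul_ofReal]), ← mul_neg_one,
    ← Complex.exp_neg_pi_mul_I, ← Complex.exp_add]
  congr 1
  push_cast
  ring

variable (ht1 : t < 1)
include ht1

lemma Logt_zpt (τ α : ℝ) (η : Fin (n - 1) → ℝ) :
    Logt t (e.zpt t γ x τ α η) = x + τ • ivec (P.v j) := by
  rw [zpt_eq_polar, Logt_polar ht ht1]

lemma slide_zpt (a : Fin n → ℝ) (τ α : ℝ) (η : Fin (n - 1) → ℝ) :
    slide t a 1 (e.zpt t γ x τ α η) = e.zpt t γ a 0 α η := by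
  rw [zpt_eq_polar, zpt_eq_polar, slide_polar a ht ht1, sub_self, zero_smul, zero_add, one_smul,
    zero_smul, add_zero]

lemma act_zpt (r β τ α : ℝ) (η : Fin (n - 1) → ℝ) :
    act (P.v j) γ r (Complex.exp (Complex.I * (β : ℂ))) (e.zpt t γ x τ α η) =
      e.zpt t γ x (τ + r / Real.log t / normSq (P.v j)) (α + β) η := by
  rw [zpt_eq_polar, zpt_eq_polar, act_polar _ _ ht ht1, angles, angles]
  congr 1 <;> module

variable {γ} in
lemma flat_zpt (hγ : P.v j ⬝ᵥ γ = 1) (α : ℝ) (η : Fin (n - 1) → ℝ) :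
    P.flat j γ t (e.zpt t γ x 0 α η) =
      e.zpt t γ x (-P.chi j x / normSq (P.v j)) Real.pi η := by
  have hlog : Real.log t ≠ 0 := (Real.log_neg ht ht1).ne
  have hangle : -(Complex.I * ((α - Real.pi : ℝ) : ℂ)) = Complex.I * ((Real.pi - α : ℝ) : ℂ) := by
    push_cast
    ring
  rw [Potential.flat, e.phase_neg_term_zpt x ht hγ, ← Complex.exp_neg, hangle,
    P.norm_term ht ht1 j (e.zpt_ne_zero t γ x 0 α η), e.Logt_zpt γ x ht ht1, zero_smul, add_zero,
    Real.log_rpow ht, e.act_zpt γ x ht ht1, zero_add, add_sub_cancel, ← neg_mul,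
    mul_div_cancel_right₀ _ hlog]

variable {γ}

lemma exists_zpt (hγ : P.v j ⬝ᵥ γ = 1) (hx : P.chi j x = 0) {y : Fin n → ℂ}
    (hy : ∀ i, y i ≠ 0) (hL : Logt t y = x) (hT : P.term t j y = -1) :
    ∃ η : Fin (n - 1) → ℝ, (∀ k, η k ∈ Set.Ico 0 (2 * Real.pi)) ∧
      y = e.zpt t γ x 0 Real.pi η := by
  obtain ⟨α₀, η₀, hθ⟩ := e.exists_angles hγ fun i => (y i).arg
  have hy₀ : y = e.zpt t γ x 0 α₀ η₀ := by
    rw [zpt_eq_polar, ← hθ, zero_smul, add_zero, ← hL, polar_Logt ht ht1 hy]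
  choose η hη hη' using fun k => exists_exp_I_mul_eq (Complex.norm_exp_I_mul_ofReal (η₀ k)) 0
  refine ⟨η, fun k => by simpa using hη k, hy₀.trans (e.zpt_congr t γ x 0 ?_ fun k => (hη' k).symm)⟩
  have hterm := e.term_zpt x ht hγ α₀ η₀
  rw [← hy₀, hT, hx, Real.rpow_zero, Complex.ofReal_one, one_mul] at hterm
  rw [← hterm, mul_comm, Complex.exp_pi_mul_I]

end zpt

end EdgeEnd

section SmallParameter

variable {N : FacetNbhd P j} {γ : Fin n → ℤ} {t : ℝ}

namespace FacetNbhd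

lemma Wj_eq_add_rest (ht : 0 < t) (ht1 : t < 1) {z : Fin n → ℂ} (hz : ∀ i, z i ≠ 0)
    (hU : Logt t z ∈ N.U) :
    N.Wj t z = 1 + P.term t j z + ((1 - N.rho (Logt t z) : ℝ) : ℂ) * N.rest t z := by
  rw [Wj, ← N.rest_eq_sum ht ht1 hz hU, N.W_eq_add_rest ht ht1 hz hU]
  push_cast
  ring

lemma norm_one_sub_rho_mul_rest_le (ht : 0 < t) (x : Fin n → ℝ) (z : Fin n → ℂ) :
    ‖((1 - N.rho x : ℝ) : ℂ) * N.rest t z‖ ≤ N.restBound t := by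
  obtain ⟨h0, h1⟩ := N.rho_mem x
  rw [norm_mul, Complex.norm_real, Real.norm_of_nonneg (by linarith)]
  exact (mul_le_of_le_one_left (norm_nonneg _) (by linarith)).trans (N.norm_rest_le ht z)

lemma restBound_nonneg (ht : 0 < t) : 0 ≤ N.restBound t :=
  Finset.sum_nonneg fun _ _ => Real.rpow_nonneg ht.le _

variable (N γ t) in
/-- The conditions on `t` under which `baseMove` carries the points of `{W = 0}` over `K` to the
torus over `a` without leaving `U`. The multiples of `v_j` in `mem_U` and `rho_eq` are as large as
the distance between an orbit of `actC` and the zero of `W` on it can be. -/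
structure IsSmall (K : Set (Fin n → ℝ)) (a : Fin n → ℝ) : Prop extends N.IsContracting γ t where
  le_exp : t ≤ Real.exp (-1)
  dot_eq : P.v j ⬝ᵥ γ = 1
  chi_eq : P.chi j a = 0
  mem : a ∈ K
  convex : Convex ℝ K
  mem_U : ∀ x ∈ K, ∀ τ : ℝ, |τ| ≤ 4 * N.restBound t / normSq (P.v j) → x + τ • ivec (P.v j) ∈ N.U
  rho_eq : ∀ τ : ℝ, |τ| ≤ 4 * N.restBound t / normSq (P.v j) →
    N.rho (a + τ • ivec (P.v j)) = 0

namespace IsSmall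

variable {K : Set (Fin n → ℝ)} {a : Fin n → ℝ} (ht : N.IsSmall γ t K a)
include ht

lemma subset_U : K ⊆ N.U := fun x hx => by
  simpa using ht.mem_U x hx 0 (by
    rw [abs_zero]
    exact div_nonneg (mul_nonneg zero_le_four (restBound_nonneg ht.pos))
      (normSq_pos_of_dotProduct_eq_one ht.dot_eq).le)

lemma one_le_abs_log : 1 ≤ |Real.log t| := by
  have := (Real.log_le_iff_le_exp ht.pos).2 ht.le_exp
  exact le_abs.2 (Or.inr (by linarith))

lemma abs_div_log_le {r : ℝ} (hr : |r| ≤ 4 * N.restBound t) :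
    |r / Real.log t / normSq (P.v j)| ≤ 4 * N.restBound t / normSq (P.v j) := by
  have hpos := normSq_pos_of_dotProduct_eq_one ht.dot_eq
  rw [abs_div, abs_of_pos hpos, abs_div]
  gcongr
  exact (div_le_self (abs_nonneg _) ht.one_le_abs_log).trans hr

lemma abs_re_root_le {y : Fin n → ℂ} (hy : ∀ i, y i ≠ 0) :
    |(N.root γ t y).re| ≤ 2 * N.restBound t :=
  (Complex.abs_re_le_norm _).trans (ht.norm_root_le hy)

lemma abs_im_root_le {y : Fin n → ℂ} (hy : ∀ i, y i ≠ 0) : |(N.root γ t y).im| ≤ 1 / 5 := by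
  linarith [(Complex.abs_im_le_norm _).trans (ht.norm_root_le hy), ht.restBound_le]

lemma Logt_baseMove_mem {s : ℝ} (hs : s ∈ Set.Icc (0 : ℝ) 1) {z : Fin n → ℂ}
    (hz : ∀ i, z i ≠ 0) (hzK : Logt t z ∈ K) : Logt t (N.baseMove γ t a s z) ∈ N.U := by
  have hflat := Potential.flat_ne_zero (P := P) (j := j) (γ := γ) ht.pos hz
  rw [Logt_baseMove ht.pos ht.lt_one s hz]
  refine ht.mem_U _ (ht.convex hzK ht.mem (sub_nonneg.2 hs.2) hs.1 (sub_add_cancel _ _)) _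
    (ht.abs_div_log_le ((abs_add_le _ _).trans ?_))
  have hscaled : |-(1 - s) * (N.root γ t (P.flat j γ t z)).re| ≤
      |(N.root γ t (P.flat j γ t z)).re| := by
    rw [abs_mul, abs_neg, abs_of_nonneg (sub_nonneg.2 hs.2)]
    exact mul_le_of_le_one_left (abs_nonneg _) (sub_le_self _ hs.1)
  linarith [ht.abs_re_root_le hflat, ht.abs_re_root_le (slide_ne_zero (t := t) a s hflat)]

/-- Over `a` the cut-off function vanishes near the zero of `W_{Σ,j}`, which is thus that of `W`. -/
lemma eq_root_of_Wj_eq_zero {y : Fin n → ℂ} (hy : ∀ i, y i ≠ 0) (hT : P.term t j y = -1)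
    {τ : ℝ} {w : ℂ} (hτ : τ = w.re / Real.log t / normSq (P.v j)) (him : |w.im| ≤ Real.pi)
    (hL : Logt t (actC (P.v j) γ w y) = a + τ • ivec (P.v j))
    (hU : a + τ • ivec (P.v j) ∈ N.U) (hW : N.Wj t (actC (P.v j) γ w y) = 0) :
    w = N.root γ t y := by
  rw [Wj_eq_add_rest ht.pos ht.lt_one (actC_ne_zero _ _ _ hy) (hL ▸ hU), hL,
    P.term_actC_self ht.dot_eq ht.pos ht.lt_one _ hy, hT] at hW
  have hsmall := norm_one_sub_rho_mul_rest_le (N := N) ht.pos (a + τ • ivec (P.v j))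
    (actC (P.v j) γ w y)
  have hhalf := hsmall.trans (ht.restBound_le.trans (by norm_num : (1 / 10 : ℝ) ≤ 1 / 2))
  have hw := eq_log_one_add_of_exp_eq hhalf (by linear_combination -hW) him
  have hre : |w.re| ≤ 4 * N.restBound t := by
    have hle := (Complex.abs_re_le_norm _).trans
      (Complex.norm_log_one_add_half_le_self hhalf)
    rw [← hw] at hle
    linarith [norm_nonneg (((1 - N.rho (a + τ • ivec (P.v j)) : ℝ) : ℂ) *
      N.rest t (actC (P.v j) γ w y))]
  have hrho : N.rho (a + τ • ivec (P.v j)) = 0 := ht.rho_eq τ (hτ ▸ ht.abs_div_log_le hre)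
  rw [hrho, sub_zero, Complex.ofReal_one, one_mul] at hw
  refine ((ht.contractingWith_rootMap hy).fixedPoint_unique' ?_ (ht.isFixedPt_root hy))
  exact hw.symm

end IsSmall

end FacetNbhd

namespace EdgeEnd

variable {f : Fin (n - 1) → TropPoly n} (e : EdgeEnd N f)

/-- For small `t`, the solution `τ_a(η)` of `W_{Σ,j} = 0` defining the singular fiber. -/
def solTau (γ : Fin n → ℤ) (t : ℝ) (a : Fin n → ℝ) (η : Fin (n - 1) → ℝ) : ℝ :=
  (N.root γ t (e.zpt t γ a 0 Real.pi η)).re / Real.log t / normSq (P.v j)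

/-- For small `t`, the solution `α_a(η)` of `W_{Σ,j} = 0` defining the singular fiber. -/
def solAlpha (γ : Fin n → ℤ) (t : ℝ) (a : Fin n → ℝ) (η : Fin (n - 1) → ℝ) : ℝ :=
  Real.pi + (N.root γ t (e.zpt t γ a 0 Real.pi η)).im

lemma actC_zpt (ht : 0 < t) (ht1 : t < 1) (x : Fin n → ℝ) (w : ℂ) (α : ℝ)
    (η : Fin (n - 1) → ℝ) : actC (P.v j) γ w (e.zpt t γ x 0 α η) =
      e.zpt t γ x (w.re / Real.log t / normSq (P.v j)) (α + w.im) η := by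
  rw [actC, e.act_zpt γ x ht ht1, zero_add]

lemma zeroOf_zpt (ht : 0 < t) (ht1 : t < 1) (a : Fin n → ℝ) (η : Fin (n - 1) → ℝ) :
    N.zeroOf γ t (e.zpt t γ a 0 Real.pi η) =
      e.zpt t γ a (e.solTau γ t a η) (e.solAlpha γ t a η) η :=
  e.actC_zpt ht ht1 a _ _ _

variable {K : Set (Fin n → ℝ)} {a : Fin n → ℝ} (ht : N.IsSmall γ t K a)
include ht

lemma term_zpt_pi (η : Fin (n - 1) → ℝ) : P.term t j (e.zpt t γ a 0 Real.pi η) = -1 := by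
  rw [e.term_zpt a ht.pos ht.dot_eq, ht.chi_eq, Real.rpow_zero, Complex.ofReal_one, one_mul,
    mul_comm, Complex.exp_pi_mul_I]

lemma abs_solTau_le (η : Fin (n - 1) → ℝ) :
    |e.solTau γ t a η| ≤ 4 * N.restBound t / normSq (P.v j) :=
  ht.abs_div_log_le <| (ht.abs_re_root_le (e.zpt_ne_zero t γ a 0 Real.pi η)).trans
    (by linarith [FacetNbhd.restBound_nonneg (N := N) ht.pos])

lemma solAlpha_mem_Ico (η : Fin (n - 1) → ℝ) : e.solAlpha γ t a η ∈ Set.Ico 0 (2 * Real.pi) := by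
  have him := abs_le.1 (ht.abs_im_root_le (e.zpt_ne_zero t γ a 0 Real.pi η))
  have := Real.pi_gt_three
  rw [solAlpha]
  constructor <;> linarith [him.1, him.2]

lemma Wj_zpt_solTau (β : ℝ) (η : Fin (n - 1) → ℝ) :
    N.Wj t (e.zpt t γ a (e.solTau γ t a η) β η) = P.W t (e.zpt t γ a (e.solTau γ t a η) β η) := by
  rw [FacetNbhd.Wj, e.Logt_zpt γ a ht.pos ht.lt_one, ht.rho_eq _ (e.abs_solTau_le ht η),
    Complex.ofReal_zero, zero_mul, sub_zero]

lemma isSol_solTau_solAlpha (η : Fin (n - 1) → ℝ) :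
    e.IsSol t γ a η (e.solTau γ t a η) (e.solAlpha γ t a η) := by
  have hU := ht.mem_U a ht.mem _ (e.abs_solTau_le ht η)
  refine ⟨hU, ?_⟩
  rw [e.Wj_zpt_solTau ht]
  have hL := e.Logt_zpt γ a ht.pos ht.lt_one (e.solTau γ t a η) (e.solAlpha γ t a η) η
  rw [← e.zeroOf_zpt ht.pos ht.lt_one] at hL ⊢
  exact ht.W_zeroOf_eq_zero ht.dot_eq (e.zpt_ne_zero t γ a 0 Real.pi η) (e.term_zpt_pi ht η)
    (hL ▸ hU)

lemma eq_of_isSol {η : Fin (n - 1) → ℝ} {τ α : ℝ} (hα : α ∈ Set.Ico 0 (2 * Real.pi))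
    (hsol : e.IsSol t γ a η τ α) : τ = e.solTau γ t a η ∧ α = e.solAlpha γ t a η := by
  have hlog : Real.log t ≠ 0 := (Real.log_neg ht.pos ht.lt_one).ne
  have hpos := normSq_pos_of_dotProduct_eq_one ht.dot_eq
  have hτ : τ = Real.log t * τ * normSq (P.v j) / Real.log t / normSq (P.v j) := by field_simp
  have hz := e.actC_zpt (γ := γ) ht.pos ht.lt_one a
    ⟨Real.log t * τ * normSq (P.v j), α - Real.pi⟩ Real.pi η
  rw [← hτ, add_sub_cancel] at hz
  have hroot := ht.eq_root_of_Wj_eq_zero (e.zpt_ne_zero t γ a 0 Real.pi η) (e.term_zpt_pi ht η) hτ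
    (abs_le.2 ⟨by linarith [hα.1], by linarith [hα.2]⟩)
    (by rw [hz, e.Logt_zpt γ a ht.pos ht.lt_one]) hsol.1 (hz ▸ hsol.2)
  rw [solTau, solAlpha, ← hroot]
  exact ⟨hτ, (add_sub_cancel _ _).symm⟩

theorem hasSingularFiber : e.HasSingularFiber t γ a := fun η _ =>
  ⟨(e.solTau γ t a η, e.solAlpha γ t a η),
    ⟨e.solAlpha_mem_Ico ht η, e.isSol_solTau_solAlpha ht η⟩,
    fun _ h => Prod.ext_iff.2 (e.eq_of_isSol ht h.1 h.2)⟩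

end EdgeEnd

/-! ### The homotopy -/

lemma balancePt_mem_Yj {R s : ℝ} (hs : s ∈ Set.Icc (0 : ℝ) 1) {q : Pt n} (hq : q ∈ N.Yj t R) :
    balancePt s q ∈ N.Yj t R := by
  obtain ⟨⟨hz, hW⟩, hu, hv, hU⟩ := hq
  have hu' : ‖q.2.1‖ ^ 2 ≤ 2 * R := by linarith
  have hv' : ‖q.2.2‖ ^ 2 ≤ 2 * R := by linarith
  refine ⟨⟨hz, (balance_mul_balance _ _ _).trans hW⟩, ?_, ?_, hU⟩
  · linarith [show ‖(balancePt s q).2.1‖ ^ 2 ≤ 2 * R from sq_norm_balance_le hs hu' hv']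
  · linarith [show ‖(balancePt s q).2.2‖ ^ 2 ≤ 2 * R from sq_norm_balance_le hs hv' hu']

namespace Potential

/-- The point of `uv = W` over `z` with `|u| = |v|` at which `u` has the phase `c`. -/
def lift (P : Potential n p) (t : ℝ) (z : Fin n → ℂ) (c : ℂ) : Pt n :=
  (z, (√‖P.W t z‖ : ℂ) * c, sqrtPhase (P.W t z) * star c)

variable {z : Fin n → ℂ} {c : ℂ}

lemma lift_eq_lift_of_W_eq_zero (hW : P.W t z = 0) (c c' : ℂ) :
    P.lift t z c = P.lift t z c' := by
  simp [lift, hW, sqrtPhase]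

lemma balancePt_one {q : Pt n} (hq : q ∈ P.Yt t) :
    balancePt 1 q = P.lift t q.1 (phase q.2.1) := by
  rw [balancePt, lift, balance_one, balance_one, mul_comm q.2.2, ← hq.2, sqrtPhase, phase_mul]
  rcases eq_or_ne q.2.1 0 with hu | hu
  · simp [hu]
  · congr 2
    linear_combination -(√‖q.2.1 * q.2.2‖ : ℂ) * phase q.2.2 *
      mul_star_of_norm_eq_one (norm_phase hu)

lemma norm_W_le (P : Potential n p) (t : ℝ) (z : Fin n → ℂ) :
    ‖P.W t z‖ ≤ 1 + ∑ k, ‖P.term t k z‖ :=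
  norm_add_le_of_le norm_one.le (norm_sum_le _ _)

lemma lift_mem_Yj (D : Deformation N t) (hz : ∀ i, z i ≠ 0) (hU : Logt t z ∈ N.U)
    (hc : P.W t z ≠ 0 → ‖c‖ = 1) : P.lift t z c ∈ N.Yj t D.R := by
  have hbound : √‖P.W t z‖ ^ 2 / 2 ≤ D.R := by
    rw [Real.sq_sqrt (norm_nonneg _)]
    linarith [D.bound z hz hU, P.norm_W_le t z, D.R'_lt, D.R''_lt]
  rcases eq_or_ne (P.W t z) 0 with hW | hW
  · rw [hW, norm_zero, Real.sqrt_zero] at hbound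
    refine ⟨⟨hz, by simp [lift, hW]⟩, ?_, ?_, hU⟩ <;> simpa [lift, hW, sqrtPhase] using hbound
  · refine ⟨⟨hz, ?_⟩, ?_, ?_, hU⟩
    · calc (√‖P.W t z‖ : ℂ) * c * (sqrtPhase (P.W t z) * star c)
          = √‖P.W t z‖ * sqrtPhase (P.W t z) * (c * star c) := by ring
        _ = P.W t z := by
          rw [sqrt_norm_mul_sqrtPhase, mul_star_of_norm_eq_one (hc hW), mul_one]
    · rwa [lift, norm_mul, hc hW, mul_one, Complex.norm_real,
        Real.norm_of_nonneg (Real.sqrt_nonneg _)]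
    · rwa [lift, norm_mul, norm_star, hc hW, mul_one, norm_sqrtPhase]

end Potential

namespace FacetNbhd

/-- The move `baseMove` lifted to the points of `uv = W` with `|u| = |v|`; the phase of `u` is
twisted in order that all phases are reached from the chain `Γ_av`. -/
def carry (N : FacetNbhd P j) (γ : Fin n → ℤ) (t : ℝ) (a : Fin n → ℝ) (s : ℝ) (q : Pt n) : Pt n :=
  P.lift t (N.baseMove γ t a s q.1) (twist s (phase q.2.1))

namespace IsSmall

variable {K : Set (Fin n → ℝ)} {a : Fin n → ℝ} (ht : N.IsSmall γ t K a)
include ht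

lemma carry_zero {q : Pt n} (hq : q ∈ P.Yt t) : N.carry γ t a 0 q = balancePt 1 q := by
  rw [carry, baseMove_zero ht.pos hq.1, twist_zero_left, Potential.balancePt_one hq]

lemma W_baseMove_eq_zero {s : ℝ} (hs : s ∈ Set.Icc (0 : ℝ) 1) {q : Pt n} (hq : q ∈ P.Yt t)
    (hK : Logt t q.1 ∈ K) (hu : q.2.1 = 0) : P.W t (N.baseMove γ t a s q.1) = 0 :=
  ht.toIsContracting.W_baseMove_eq_zero ht.dot_eq ht.chi_eq s hq.1 (ht.subset_U hK)
    (ht.Logt_baseMove_mem hs hq.1 hK) (by rw [← hq.2, hu, zero_mul])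

lemma carry_mem_Yj (D : Deformation N t) {s : ℝ} (hs : s ∈ Set.Icc (0 : ℝ) 1) {q : Pt n}
    (hq : q ∈ P.Yt t) (hK : Logt t q.1 ∈ K) : N.carry γ t a s q ∈ N.Yj t D.R :=
  Potential.lift_mem_Yj D (baseMove_ne_zero ht.pos s hq.1) (ht.Logt_baseMove_mem hs hq.1 hK)
    fun hW => by rw [norm_twist, norm_phase fun hu => hW (ht.W_baseMove_eq_zero hs hq hK hu)]

lemma continuousOn_carry : ContinuousOn (fun w : ℝ × Pt n => N.carry γ t a w.1 w.2)
    {w | w.1 ∈ Set.Icc (0 : ℝ) 1 ∧ w.2 ∈ P.Yt t ∧ Logt t w.2.1 ∈ K} := by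
  rintro ⟨s, z, u, v⟩ ⟨hs, hq, hK⟩
  have hbase : ContinuousAt (fun w : ℝ × Pt n => N.baseMove γ t a w.1 w.2.1) (s, z, u, v) :=
    ContinuousAt.comp (g := fun w : ℝ × (Fin n → ℂ) => N.baseMove γ t a w.1 w.2)
      (f := fun w : ℝ × Pt n => (w.1, w.2.1))
      (ht.continuousAt_baseMove s hq.1) (by fun_prop)
  have hW : ContinuousAt (fun w : ℝ × Pt n => P.W t (N.baseMove γ t a w.1 w.2.1)) (s, z, u, v) :=
    ContinuousAt.comp (g := P.W t) (P.continuousAt_W t (baseMove_ne_zero ht.pos s hq.1)) hbase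
  have hsqrt : ContinuousAt
      (fun w : ℝ × Pt n => (√‖P.W t (N.baseMove γ t a w.1 w.2.1)‖ : ℂ)) (s, z, u, v) := by
    fun_prop
  have hsqrtPhase : ContinuousAt
      (fun w : ℝ × Pt n => sqrtPhase (P.W t (N.baseMove γ t a w.1 w.2.1))) (s, z, u, v) :=
    ContinuousAt.comp (g := sqrtPhase) continuous_sqrtPhase.continuousAt hW
  refine hbase.continuousWithinAt.prodMk ?_
  rcases eq_or_ne u 0 with rfl | hu
  · have hW0 := ht.W_baseMove_eq_zero hs hq hK rfl
    have hle (w : ℝ × Pt n) : ‖twist w.1 (phase w.2.2.1)‖ ≤ 1 :=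
      (norm_twist _ _).le.trans (norm_phase_le_one _)
    exact (continuousWithinAt_mul_of_eq_zero hsqrt.continuousWithinAt (by simp [hW0]) hle).prodMk
      (continuousWithinAt_mul_of_eq_zero hsqrtPhase.continuousWithinAt
        (by simp [hW0, sqrtPhase]) fun w => (norm_star _).le.trans (hle w))
  · have hphase : ContinuousAt (fun w : ℝ × Pt n => phase w.2.2.1) (s, z, u, v) :=
      ContinuousAt.comp (f := fun w : ℝ × Pt n => w.2.2.1) (continuousAt_phase hu) (by fun_prop)
    have htwist : ContinuousAt (fun w : ℝ × Pt n => twist w.1 (phase w.2.2.1)) (s, z, u, v) :=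
      ContinuousAt.comp (g := fun w : ℝ × ℂ => twist w.1 w.2)
        (f := fun w : ℝ × Pt n => (w.1, phase w.2.2.1))
        continuous_twist.continuousAt (continuousAt_fst.prodMk hphase)
    exact ((hsqrt.mul htwist).prodMk (hsqrtPhase.mul htwist.star)).continuousWithinAt

/-- First balance `|u|` and `|v|`, then `carry`. -/
lemma exists_homotopy (D : Deformation N t) {S : Set (Pt n)} (hS : S ⊆ N.Yj t D.R)
    (hK : ∀ q ∈ S, Logt t q.1 ∈ K) :
    ∃ H : S × unitInterval → N.Yj t D.R, Continuous H ∧ (∀ q, (H (q, 0) : Pt n) = q) ∧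
      ∀ q, (H (q, 1) : Pt n) = N.carry γ t a 1 q := by
  obtain ⟨f₁, hf₁, F⟩ := exists_homotopic_of_continuousOn
    (continuousOn_balancePt.mono fun w (hw : w ∈ Set.Icc 0 1 ×ˢ S) => hw.1.2)
    (fun w hw => balancePt_mem_Yj hw.1 (hS hw.2))
    ⟨Set.inclusion hS, continuous_inclusion hS⟩ fun q => (balancePt_zero _).symm
  obtain ⟨f₂, hf₂, G⟩ := exists_homotopic_of_continuousOn
    (ht.continuousOn_carry.mono fun w (hw : w ∈ Set.Icc 0 1 ×ˢ S) =>
      ⟨hw.1, (hS hw.2).1, hK _ hw.2⟩)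
    (fun w hw => ht.carry_mem_Yj D hw.1 (hS hw.2).1 (hK _ hw.2)) f₁
    fun q => (hf₁ q).trans (ht.carry_zero (hS q.2).1).symm
  obtain ⟨H⟩ := F.trans G
  exact ⟨fun w => H (w.2, w.1), by fun_prop, fun q => by simp,
    fun q => (congrArg Subtype.val (H.apply_one q)).trans (hf₂ q)⟩

end IsSmall

end FacetNbhd

namespace EdgeEnd

variable {f : Fin (n - 1) → TropPoly n} (e : EdgeEnd N f) {K : Set (Fin n → ℝ)} {a : Fin n → ℝ}
  (ht : N.IsSmall γ t K a)
include ht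

lemma mem_SF_iff {y : Pt n} : y ∈ e.SF t γ a ↔
    ∃ η : Fin (n - 1) → ℝ, (∀ k, η k ∈ Set.Icc 0 (2 * Real.pi)) ∧
      ∃ ηa ∈ Set.Icc 0 (2 * Real.pi), ∃ θ ∈ Set.Icc 0 (2 * Real.pi),
        y = P.lift t (e.zpt t γ a (e.solTau γ t a η) (e.solAlpha γ t a η + ηa) η)
          (Complex.exp (Complex.I * (θ : ℂ))) := by
  have hstar (θ : ℝ) : star (Complex.exp (Complex.I * (θ : ℂ))) =
      Complex.exp (-(Complex.I * (θ : ℂ))) := by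
    rw [Complex.star_def, ← Complex.exp_conj]
    simp
  constructor
  · rintro ⟨η, hη, ηa, hηa, θ, hθ, τ, α, hα, hsol, hz, hu, hv⟩
    obtain ⟨rfl, rfl⟩ := e.eq_of_isSol ht hα hsol
    rw [hz, e.Wj_zpt_solTau ht] at hu hv
    rw [mul_inv_sqrt_norm, ← hstar] at hv
    exact ⟨η, hη, ηa, hηa, θ, hθ, Prod.ext hz (Prod.ext hu hv)⟩
  · rintro ⟨η, hη, ηa, hηa, θ, hθ, rfl⟩
    refine ⟨η, hη, ηa, hηa, θ, hθ, e.solTau γ t a η, e.solAlpha γ t a η, e.solAlpha_mem_Ico ht η,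
      e.isSol_solTau_solAlpha ht η, rfl, ?_, ?_⟩
    · rw [Potential.lift, e.Wj_zpt_solTau ht]
    · rw [Potential.lift, e.Wj_zpt_solTau ht, mul_inv_sqrt_norm, hstar]

lemma baseMove_one {z : Fin n → ℂ} {η : Fin (n - 1) → ℝ}
    (hη : slide t a 1 (P.flat j γ t z) = e.zpt t γ a 0 Real.pi η) {β : ℝ}
    (hβ : twist 2 (N.relPhase γ t z) = Complex.exp (Complex.I * (β : ℂ))) :
    N.baseMove γ t a 1 z = e.zpt t γ a (e.solTau γ t a η) (e.solAlpha γ t a η + β) η := by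
  rw [FacetNbhd.baseMove, hη, e.zeroOf_zpt ht.pos ht.lt_one, sub_self, zero_mul, mul_one, hβ,
    e.act_zpt γ a ht.pos ht.lt_one, zero_div, zero_div, add_zero]

lemma carry_one_mem_SF {q : Pt n} (hq : q ∈ P.Yt t) (hK : Logt t q.1 ∈ K) :
    N.carry γ t a 1 q ∈ e.SF t γ a := by
  have hflat := Potential.flat_ne_zero (P := P) (j := j) (γ := γ) ht.pos hq.1
  obtain ⟨η, hη, hz⟩ := e.exists_zpt a ht.pos ht.lt_one ht.dot_eq ht.chi_eq
    (slide_ne_zero a 1 hflat)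
    (by rw [Logt_slide a ht.pos ht.lt_one 1 hflat, sub_self, zero_smul, zero_add, one_smul])
    (ht.term_slide_flat ht.dot_eq ht.chi_eq 1 hq.1)
  obtain ⟨β, hβ, hβ'⟩ := exists_exp_I_mul_eq (c := twist 2 (N.relPhase γ t q.1))
    (by rw [norm_twist, FacetNbhd.norm_relPhase ht.pos hq.1]) 0
  rw [zero_add] at hβ
  refine (e.mem_SF_iff ht).2
    ⟨η, fun k => Set.Ico_subset_Icc_self (hη k), β, Set.Ico_subset_Icc_self hβ, ?_⟩
  rw [← e.baseMove_one ht hz hβ'.symm, FacetNbhd.carry]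
  rcases eq_or_ne q.2.1 0 with hu | hu
  · exact ⟨0, ⟨le_rfl, Real.two_pi_pos.le⟩, Potential.lift_eq_lift_of_W_eq_zero
      (ht.W_baseMove_eq_zero ⟨zero_le_one, le_rfl⟩ hq hK hu) _ _⟩
  · obtain ⟨θ, hθ, hθ'⟩ := exists_exp_I_mul_eq (c := twist 1 (phase q.2.1))
      (by rw [norm_twist, norm_phase hu]) 0
    rw [zero_add] at hθ
    exact ⟨θ, Set.Ico_subset_Icc_self hθ, by rw [hθ']⟩

/-- The twist already maps the arc `[π/6, 5π/6]` onto the circle, which leaves a margin for the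
angle, at most `1/5`, by which the zero of `W` is displaced. -/
lemma exists_baseMove_one_eq (x : Fin n → ℝ) (η : Fin (n - 1) → ℝ) (ηa : ℝ) :
    ∃ α ∈ Set.Icc Real.pi (2 * Real.pi), N.baseMove γ t a 1 (e.zpt t γ x 0 α η) =
      e.zpt t γ a (e.solTau γ t a η) (e.solAlpha γ t a η + ηa) η := by
  set y := e.zpt t γ x (-P.chi j x / normSq (P.v j)) Real.pi η
  have him := abs_le.1 (ht.abs_im_root_le (e.zpt_ne_zero t γ x _ _ η : ∀ i, y i ≠ 0))
  obtain ⟨β, ⟨hβ, hβ'⟩, htwist⟩ := exists_twist_two_eq (Complex.norm_exp_I_mul_ofReal ηa)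
  have hpi := Real.pi_gt_three
  refine ⟨β + Real.pi + (N.root γ t y).im, ⟨by linarith, by linarith⟩, e.baseMove_one ht ?_ ?_⟩
  · rw [e.flat_zpt x ht.pos ht.lt_one ht.dot_eq, e.slide_zpt γ x ht.pos ht.lt_one]
  · rw [← htwist, FacetNbhd.relPhase, e.flat_zpt x ht.pos ht.lt_one ht.dot_eq,
      e.phase_neg_term_zpt x ht.pos ht.dot_eq, ← Complex.exp_add]
    congr 2
    push_cast
    ring

lemma exists_carry_one_eq {A : AddData n} (hA : A.γ = γ) (hrp : 0 < A.rp (1 / 2)) {y : Pt n}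
    (hy : y ∈ e.SF t γ a) : ∃ q ∈ e.GammaAv t A, N.carry γ t a 1 q = y := by
  obtain ⟨η, hη, ηa, -, θ, hθ, rfl⟩ := (e.mem_SF_iff ht).1 hy
  obtain ⟨α, hα, hmove⟩ := e.exists_baseMove_one_eq ht (A.r (1 / 2)) η ηa
  have hpi := Real.pi_pos
  obtain ⟨h, rfl⟩ : ∃ h, α = 2 * Real.pi * h := ⟨α / (2 * Real.pi), by field_simp⟩
  have hhalf : 1 / 2 ≤ h := by nlinarith [hα.1]
  obtain ⟨m, hm, hmem⟩ := e.exists_zpt_mem_cyc γ (A.r (1 / 2)) ht.pos h hη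
  set z := e.zpt t γ (A.r (1 / 2)) 0 (2 * Real.pi * h) η
  have hsqrt : 0 < √(2 * A.rp (1 / 2)) := Real.sqrt_pos.2 (by linarith)
  set u : ℂ := Complex.exp (Complex.I * ((θ / 2 : ℝ) : ℂ)) * (√(2 * A.rp (1 / 2)) : ℂ) with hu
  have hu₀ : u ≠ 0 := mul_ne_zero (Complex.exp_ne_zero _) (Complex.ofReal_ne_zero.2 hsqrt.ne')
  have hphase : phase u = Complex.exp (Complex.I * ((θ / 2 : ℝ) : ℂ)) := by
    rw [hu, phase_mul, phase_ofReal_of_pos hsqrt, mul_one,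
      phase_of_norm_eq_one (Complex.norm_exp_I_mul_ofReal _)]
  have hangle : θ / (4 * Real.pi * h) * (2 * Real.pi * h) = θ / 2 := by field_simp; ring
  refine ⟨(z, u, P.W t z / u), ⟨⟨e.zpt_ne_zero t γ _ _ _ η, mul_div_cancel₀ _ hu₀⟩, m, hm, h,
    ⟨by linarith, by nlinarith [hα.2]⟩, θ / (4 * Real.pi * h), ⟨?_, ?_⟩, hA ▸ hmem, ?_⟩, ?_⟩
  · exact div_nonneg hθ.1 (by positivity)
  · exact (div_le_one (by positivity)).2 (by nlinarith [hθ.2])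
  · rw [hangle]
  · rw [FacetNbhd.carry, hmove, hphase, twist_one_exp_half hθ]

end EdgeEnd

end SmallParameter

/-! ### The limit `t → 0` -/

open Filter Topology

namespace FacetNbhd

variable (N : FacetNbhd P j)

lemma mem_facet {x : Fin n → ℝ} (hx : x ∈ N.U) (hchi : P.chi j x = 0) : x ∈ P.facet j := by
  refine ⟨fun k => ?_, hchi⟩
  rcases eq_or_ne k j with rfl | hk
  · exact hchi.ge
  · exact (N.c_pos.trans ((N.c_lt k hk).trans (N.lt_chi x hx k hk))).le

/-- The hyperplane `χ_j = 0` is connected and unbounded and meets `U'`, so it meets the boundary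
of `U'`. -/
lemma exists_mem_facet_notMem_U' (hn : 2 ≤ n) : ((P.facet j ∩ N.U) \ N.U').Nonempty := by
  let φ : (Fin n → ℝ) →ₗ[ℝ] ℝ :=
    IsLinearMap.mk' (pair (P.v j)) ⟨pair_add _, pair_smul _⟩
  have hconn : IsPreconnected {x | P.chi j x = 0} := by
    have hconvex := (convex_singleton (𝕜 := ℝ) (-P.lam j)).linear_preimage φ
    convert hconvex.isPreconnected using 1
    ext x
    change P.lam j + pair (P.v j) x = 0 ↔ pair (P.v j) x = -P.lam j
    rw [add_comm, eq_neg_iff_add_eq_zero]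
  obtain ⟨x₀, hx₀, hfacet⟩ := N.meets_facet
  obtain ⟨C, hC⟩ := N.compact_U'.isBounded.exists_norm_le
  have hker : Nontrivial φ.ker := Submodule.nontrivial_iff_ne_bot.2
    (LinearMap.ker_ne_bot_of_finrank_lt (by
      rw [Module.finrank_self, Module.finrank_fin_fun]
      omega))
  obtain ⟨⟨y, hy⟩, hCy⟩ := NormedSpace.exists_lt_norm ℝ φ.ker (C + ‖x₀‖)
  have hfar : x₀ + y ∉ N.U' := fun hmem => by
    have := norm_sub_le (x₀ + y) x₀
    rw [add_sub_cancel_left] at this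
    have := hC _ (subset_closure hmem)
    change C + ‖x₀‖ < ‖y‖ at hCy
    linarith
  have hchi : P.chi j (x₀ + y) = 0 := by
    have hpair : pair (P.v j) y = 0 := hy
    rw [Potential.chi, pair_add, hpair, add_zero]
    exact hfacet.2
  obtain ⟨x, hx, hfrontier⟩ := nonempty_inter_frontier_of_isPreconnected hconn
    ⟨x₀, hfacet.2, N.closure_U'' (subset_closure hx₀)⟩ ⟨x₀ + y, hchi, hfar⟩
  have hU := N.closure_U' hfrontier.1
  exact ⟨x, ⟨N.mem_facet hU hx, hU⟩, N.isOpen_U'.interior_eq ▸ hfrontier.2⟩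

lemma tendsto_sum_rpow_mul (C : Fin p → ℝ) :
    Tendsto (fun t : ℝ => ∑ k ∈ Finset.univ.erase j, t ^ N.c k * C k) (𝓝[>] 0) (𝓝 0) := by
  have hterm (k : Fin p) (hk : k ∈ Finset.univ.erase j) :
      Tendsto (fun t : ℝ => t ^ N.c k * C k) (𝓝[>] 0) (𝓝 0) := by
    have hc : 0 < N.c k := N.c_pos.trans (N.c_lt k (Finset.ne_of_mem_erase hk))
    have hpow := ((Real.continuous_rpow_const hc.le).tendsto 0).mul_const (C k)
    rw [Real.zero_rpow hc.ne', zero_mul] at hpow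
    exact hpow.mono_left nhdsWithin_le_nhds
  simpa using tendsto_finsetSum _ hterm

lemma tendsto_restBound : Tendsto N.restBound (𝓝[>] 0) (𝓝 0) := by
  have h := N.tendsto_sum_rpow_mul fun _ => 1
  simp only [mul_one] at h
  exact h

lemma eventually_isSmall {γ : Fin n → ℤ} (hγ : P.v j ⬝ᵥ γ = 1) {K : Set (Fin n → ℝ)}
    (hK : IsCompact K) (hconvex : Convex ℝ K) (hKU : K ⊆ N.U) {a : Fin n → ℝ} (ha : a ∈ K)
    (hfacet : a ∈ P.facet j) (haU' : a ∉ N.U') : ∀ᶠ t in 𝓝[>] 0, N.IsSmall γ t K a := by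
  obtain ⟨δ, hδ, hKδ⟩ := hK.exists_thickening_subset_open N.isOpen_U hKU
  obtain ⟨ε, hε, hrho⟩ := N.rho_const
  have hlip : Tendsto (N.restLip γ) (𝓝[>] 0) (𝓝 0) := N.tendsto_sum_rpow_mul _
  have hdisp : Tendsto (fun t => 4 * N.restBound t / normSq (P.v j)) (𝓝[>] 0) (𝓝 0) := by
    simpa using (N.tendsto_restBound.const_mul 4).div_const (normSq (P.v j))
  have hdisp' := hdisp.mul_const ‖ivec (P.v j)‖
  rw [zero_mul] at hdisp'
  filter_upwards [self_mem_nhdsWithin, nhdsWithin_le_nhds (Iio_mem_nhds (Real.exp_pos (-1))),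
    N.tendsto_restBound.eventually_le_const (by norm_num : (0 : ℝ) < 1 / 10),
    hlip.eventually_le_const (by norm_num : (0 : ℝ) < 1 / 4), hdisp.eventually_lt_const hε,
    hdisp'.eventually_lt_const hδ] with t ht hexp hbound hlip hε hδ
  exact
    { pos := ht
      lt_one := hexp.trans (Real.exp_lt_one_iff.2 (by norm_num))
      restBound_le := hbound
      restLip_le := hlip
      le_exp := hexp.le
      dot_eq := hγ
      chi_eq := hfacet.2
      mem := ha
      convex := hconvex
      mem_U := fun x hx τ hτ => hKδ <| Metric.mem_thickening_iff.2 ⟨x, hx, by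
        rw [dist_eq_norm, add_sub_cancel_left, norm_smul, Real.norm_eq_abs]
        exact (mul_le_mul_of_nonneg_right hτ (norm_nonneg _)).trans_lt hδ⟩
      rho_eq := fun τ hτ => by
        rw [hrho a ⟨hKU ha, hfacet⟩ τ (hτ.trans_lt hε), N.rho_zero a haU'] }

end FacetNbhd

namespace EdgeEnd

variable {N : FacetNbhd P j} {f : Fin (n - 1) → TropPoly n} (e : EdgeEnd N f)

/-- A subset of `U` over which `Γ_{a,total}` lies, where `r = r_add`. -/
def shadow (r : ℝ → Fin n → ℝ) : Set (Fin n → ℝ) :=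
  closure N.U' ∪ e.ra '' Set.Icc 0 1 ∪ r '' Set.Icc 0 1

variable {r : ℝ → Fin n → ℝ}

lemma isCompact_shadow (hr : ContinuousOn r (Set.Icc 0 1)) : IsCompact (e.shadow r) := by
  have hra : Continuous e.ra := by
    unfold ra
    fun_prop
  exact (N.compact_U'.union (isCompact_Icc.image hra)).union
    (isCompact_Icc.image_of_continuousOn hr)

lemma shadow_subset_U (hr : Set.MapsTo r (Set.Icc 0 1) N.U) : e.shadow r ⊆ N.U := by
  rintro x ((hx | ⟨τ, hτ, rfl⟩) | ⟨τ, hτ, rfl⟩)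
  · exact N.closure_U' hx
  · exact e.mem_U _ ⟨mul_nonneg (by linarith [hτ.2]) e.len_pos.le,
      mul_le_of_le_one_left e.len_pos.le (by linarith [hτ.1])⟩
  · exact hr hτ

variable {t : ℝ}

lemma Logt_mem_shadow_of_mem_GammaA (D : Deformation N t) {s : ℝ → Fin n → ℂ}
    (hs : ∀ τ ∈ Set.Icc (0 : ℝ) 1, Logt t (s τ) = e.ra τ) {q : Pt n} (hq : q ∈ e.GammaA D s) :
    Logt t q.1 ∈ e.shadow r := by
  obtain ⟨hY, y, -, hy, -, τ, hτ, hmem⟩ := hq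
  by_cases hbox : inBox t D.R' N.U' q
  · exact Or.inl (Or.inl (subset_closure hbox.2.2))
  · rw [← hy, D.eq_id q hY hbox] at hmem
    rw [Logt_eq_of_mem_cyc hmem, hs τ hτ]
    exact Or.inl (Or.inr ⟨τ, hτ, rfl⟩)

lemma Logt_mem_shadow_of_mem_GammaAdd (ht : 0 < t) (ht1 : t < 1) {A : AddData n} {q : Pt n}
    (hq : q ∈ e.GammaAdd t A) : Logt t q.1 ∈ e.shadow A.r := by
  suffices h : ∃ τ ∈ Set.Icc (0 : ℝ) 1, ∃ σ, q.1 ∈ cyc σ (sreal t (A.r τ)) by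
    obtain ⟨τ, hτ, σ, hσ⟩ := h
    rw [Logt_eq_of_mem_cyc hσ, Logt_sreal ht ht1]
    exact Or.inr ⟨τ, hτ, rfl⟩
  have hhalf : (1 / 2 : ℝ) ∈ Set.Icc (0 : ℝ) 1 := by constructor <;> norm_num
  rcases hq with (((((h | h) | h) | h) | h) | h) | h
  · obtain ⟨-, τ, hτ, h, -⟩ := h
    exact ⟨τ, ⟨hτ.1, hτ.2.trans hhalf.2⟩, _, h⟩
  · obtain ⟨-, m, -, η, -, κ, -, h, -⟩ := h
    exact ⟨_, hhalf, _, h⟩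
  · obtain ⟨-, τ, hτ, h, -⟩ := h
    exact ⟨τ, ⟨hhalf.1.trans hτ.1, hτ.2⟩, _, h⟩
  · obtain ⟨-, τ, hτ, h, -⟩ := h
    exact ⟨τ, hτ, _, h⟩
  · exact ⟨0, ⟨le_rfl, zero_le_one⟩, _, h.2.1⟩
  · exact ⟨1, ⟨zero_le_one, le_rfl⟩, _, h.2.1⟩
  · exact ⟨_, hhalf, _, h.2.1⟩

lemma GammaAv_subset_GammaTotal (D : Deformation N t) (s : ℝ → Fin n → ℂ) (A : AddData n) :
    e.GammaAv t A ⊆ e.GammaTotal D s A := fun _ h =>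
  Or.inr (Or.inl (Or.inl (Or.inl (Or.inl (Or.inl (Or.inr h))))))

theorem exists_homotopy_range_eq_SF {γ : Fin n → ℤ} {K : Set (Fin n → ℝ)} {a : Fin n → ℝ}
    (ht : N.IsSmall γ t K a) (D : Deformation N t) {A : AddData n} (hA : A.γ = γ)
    (hrp : 0 < A.rp (1 / 2)) {S : Set (Pt n)} (hS : S ⊆ N.Yj t D.R)
    (hK : ∀ q ∈ S, Logt t q.1 ∈ K) (hAv : e.GammaAv t A ⊆ S) :
    ∃ H : S × unitInterval → N.Yj t D.R, Continuous H ∧ (∀ q, (H (q, 0) : Pt n) = q) ∧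
      Set.range (fun q => (H (q, 1) : Pt n)) = e.SF t γ a := by
  obtain ⟨H, hH, hzero, hone⟩ := ht.exists_homotopy D hS hK
  refine ⟨H, hH, hzero, Set.Subset.antisymm ?_ fun y hy => ?_⟩
  · rintro _ ⟨q, rfl⟩
    simp only [hone]
    exact e.carry_one_mem_SF ht (hS q.2).1 (hK q q.2)
  · obtain ⟨q, hq, rfl⟩ := e.exists_carry_one_eq ht hA hrp hy
    exact ⟨⟨q, hAv hq⟩, hone _⟩

end EdgeEnd

theorem mainTheorem4_general (N : FacetNbhd P j) {f : Fin (n - 1) → TropPoly n}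
    (e : EdgeEnd N f) {γ : Fin n → ℤ} (hγ : P.v j ⬝ᵥ γ = 1) {r : ℝ → Fin n → ℝ}
    (hr : ContinuousOn r (Set.Icc 0 1)) (hrU : Set.MapsTo r (Set.Icc 0 1) N.U)
    {a : Fin n → ℝ} (ha : a ∈ (P.facet j ∩ N.U) \ N.U') :
    ∃ t₀ > 0, ∀ t : ℝ, 0 < t → t < t₀ →
      e.HasSingularFiber t γ a ∧
      ∀ (D : Deformation N t) (s : ℝ → Fin n → ℂ),
        (∀ τ ∈ Set.Icc (0 : ℝ) 1, Logt t (s τ) = e.ra τ) →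
      ∀ A : EdgeEnd.AddData n, A.γ = γ → A.r = r → 0 < A.rp (1 / 2) →
      e.GammaAdd t A ⊆ N.Yj t D.R →
      ∃ H : e.GammaTotal D s A × unitInterval → N.Yj t D.R, Continuous H ∧
        (∀ q, (H (q, 0) : Pt n) = q) ∧
        Set.range (fun q => (H (q, 1) : Pt n)) = e.SF t γ a := by
  obtain ⟨K, hK, hconvex, hsub, hKU⟩ := exists_isCompact_convex_between
    ((e.isCompact_shadow hr).insert a) N.isOpen_U N.convex_U
    (Set.insert_subset ha.1.2 (e.shadow_subset_U hrU))
  obtain ⟨t₀, ht₀, hsmall⟩ := mem_nhdsGT_iff_exists_Ioo_subset.1 <|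
    N.eventually_isSmall hγ hK hconvex hKU (hsub (Set.mem_insert _ _)) ha.1.1 ha.2
  refine ⟨t₀, ht₀, fun t hpos hlt => ?_⟩
  have ht := hsmall ⟨hpos, hlt⟩
  refine ⟨e.hasSingularFiber ht, ?_⟩
  rintro D s hs A hA rfl hrp hAdd
  refine e.exists_homotopy_range_eq_SF ht D hA hrp
    (Set.union_subset (fun _ hq => hq.1) hAdd) (fun q hq => hsub (Or.inr ?_))
    (e.GammaAv_subset_GammaTotal D s A)
  exact hq.elim (e.Logt_mem_shadow_of_mem_GammaA D hs)
    (e.Logt_mem_shadow_of_mem_GammaAdd ht.pos ht.lt_one)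

end HV

end

theorem mainTheorem4 {n p : ℕ} (hn : 2 ≤ n) (P : HV.Potential n p) (j : Fin p)
    (N : HV.FacetNbhd P j) (f : Fin (n - 1) → HV.TropPoly n) (e : HV.EdgeEnd N f)
    (γ : Fin n → ℤ) (hγ : ∑ i, γ i * P.v j i = 1)
    (radd : ℝ → Fin n → ℝ) (hradd : e.IsAddPath radd) :
    ∃ t₀ > 0, ∀ t : ℝ, 0 < t → t < t₀ →
      ∀ (D : HV.Deformation N t) (s : ℝ → Fin n → ℂ), e.IsLift t s →
      ∀ A : HV.EdgeEnd.AddData n, A.γ = γ → A.r = radd → HV.EdgeEnd.IsAdmissible N t A →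
      e.GammaAdd t A ⊆ N.Yj t D.R →
      ∃ a' ∈ (P.facet j ∩ N.U) \ N.U', e.HasSingularFiber t γ a' ∧
        ∃ H : ↥(e.GammaTotal D s A) × unitInterval → ↥(N.Yj t D.R), Continuous H ∧
          (∀ x : ↥(e.GammaTotal D s A), (H (x, 0) : HV.Pt n) = x) ∧
          Set.range (fun x : ↥(e.GammaTotal D s A) => (H (x, 1) : HV.Pt n)) =
            e.SF t γ a' := by
  obtain ⟨a, ha⟩ := N.exists_mem_facet_notMem_U' hn
  obtain ⟨t₀, ht₀, h⟩ := HV.mainTheorem4_general N e ((dotProduct_comm _ _).trans hγ)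
    hradd.cont hradd.mem_U ha
  refine ⟨t₀, ht₀, fun t ht htt₀ D s hs A hAγ hAr hA hAdd => ?_⟩
  obtain ⟨hfiber, hhom⟩ := h t ht htt₀
  exact ⟨a, ha, hfiber,
    hhom D s hs.log_eq A hAγ hAr (hA.rp_pos _ (by constructor <;> norm_num)) hAdd⟩
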